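/- **Setting.** Identify a Dirichlet series $\sum_{n\ge1}f(n)n^{-s}$ with the sequence $f:\mathbf N\to\mathbf C$, where $\mathbf N=\{1,2,\dots\}$. Column-finite complex matrices $A=(a_{m,n})_{m,n\in\mathbf N}$ act on such series from the right by $(fA)(n)=\sum_m a_{m,n}f(m)$. Let $S=\begin{pmatrix}0&-1\\1&0\end{pmatrix}$, $T=\begin{pmatrix}1&1\\0&1\end{pmatrix}$. The representation $\rho$ of $\mathrm{SL}(2,\mathbf Z)$ by invertible column-finite matrices is constructed as follows. * Let $b_0=b_1=1$ and $b_n=-\sum_{i+j=n,\ i,j\ge1}b_ib_j$ for $n\ge2$. Put $B_0=T$, $B_1=\begin{pmatrix}0&1\\1&1\end{pmatrix}$, $B_n=\begin{pmatrix}0&b_n\\b_n&0\end{pmatrix}$ for $n\ge2$. Let $\tilde J$ be the block upper triangular matrix whose $(r,c)$ block is $B_{c-r}$ for $r\le c$, and let $\tilde S=\mathrm{diag}(S,S,\dots)$. There is a unique representation $\tau_1$ of $\mathrm{SL}(2,\mathbf Z)$ with $\tau_1(S)=\tilde S$, $\tau_1(T)=\tilde J$. * Let $P$ be the (upper unitriangular)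 matrix whose $n$-th row is the first row of $(\tilde J-I)^{n-1}$. * Let $D$ be the divisor matrix ($d_{i,j}=1$ if $i\mid j$, and $0$ otherwise) and let $Z$ be the (upper unitriangular) matrix whose row $2^kd$, for $d$ odd and $k\ge 0$, is row $d$ of $(D-I)^k$. * For a column-finite matrix $A$ let $\psi(A)$ be the matrix with $\psi(A)_{2^{k-1}d,\,2^{\ell-1}d}=A_{k,\ell}$ for all odd $d$ and all $k,\ell\in\mathbf N$, and all other entries $0$. * $\rho(Y)=Z^{-1}\,\psi\bigl(P\,\tau_1(Y)\,P^{-1}\bigr)\,Z$ for $Y\in\mathrm{SL}(2,\mathbf Z)$. Write $1$ for the Dirichlet series with the single term $1^{-s}$, put $\varphi=1.\rho(-S)$, and let $\sigma_c$ be the abscissa of (conditional) convergence of $\varphi(s)$. **Theorem.** The Dirichlet series $1$, $\zeta(s)=\sum_n n^{-s}$ and $\varphi(s)$ lie in one and the same $\mathrm{SL}(2,\mathbf Z)$-orbit under $\rho$. The abscissa $\sigma_c$ is not $+\infty$, and every Dirichlet series in this common orbit converges for $\mathrm{Re}(s)>\max(1,\sigma_c)$ and defines an analytic function there. In the field of meromorphic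 functions on this half-plane, each of these functions belongs to the subfield $\mathbf C(\zeta(s),\varphi(s))$, and more precisely to the additive subgroup generated by the elements $\zeta(s)^m$ and $\varphi(s)\zeta(s)^m$, $m\in\mathbf Z$. -/

import Mathlib

noncomputable section

namespace DivisorSL2

section Representation

open PowerSeries Matrix MatrixGroups

/-! ### Homomorphisms out of `SL(2, ℤ)` -/

/-- The relations `s ^ 4 = 1`, `(s t) ^ 3 = s ^ 2` (with `s ^ 2` central) define `SL(2, ℤ)`. -/
theorem exists_hom_SL2Z {A : Type*} [Group A] (s t : A) (hs : s ^ 4 = 1)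
    (hst : (s * t) ^ 3 = s ^ 2) (hc : t * s ^ 2 = s ^ 2 * t) :
    ∃ f : SL(2, ℤ) →* A, f ModularGroup.S = s ∧ f ModularGroup.T = t := by
  obtain ⟨σ, hσ⟩ : ∃ σ : SL(2, ℤ) × A, σ = (ModularGroup.S, s) := ⟨_, rfl⟩
  obtain ⟨τ, hτ⟩ : ∃ τ : SL(2, ℤ) × A, τ = (ModularGroup.T, t) := ⟨_, rfl⟩
  have h4 : σ ^ 4 = 1 := by
    subst hσ; exact Prod.ext (show ModularGroup.S ^ 4 = 1 by decide) hs
  have hcc : τ * σ ^ 2 = σ ^ 2 * τ := by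
    subst hσ hτ; exact Prod.ext (show ModularGroup.T * ModularGroup.S ^ 2 = ModularGroup.S ^ 2 * ModularGroup.T by decide) hc
  have h6 : (σ * τ) ^ 3 = σ ^ 2 := by
    subst hσ hτ; exact Prod.ext (show (ModularGroup.S * ModularGroup.T) ^ 3 = ModularGroup.S ^ 2 by decide) hst
  have h5 : τ * σ * τ * σ * τ = σ := by
    have : σ * (τ * σ * τ * σ * τ) = σ * σ := by
      rw [← pow_two, ← h6]; simp only [pow_succ, pow_zero, one_mul, mul_assoc]
    exact mul_left_cancel this
  have hτi : τ⁻¹ = σ * τ * σ * τ * σ * σ * σ := by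
    rw [_root_.inv_eq_iff_mul_eq_one]
    have : τ * (σ * τ * σ * τ * σ * σ * σ) = (τ * σ * τ * σ * τ) * σ ^ 3 := by
      simp only [pow_succ, pow_zero, one_mul, mul_assoc]
    rw [this, h5, ← pow_succ', h4]
  have hσi : σ⁻¹ = σ * σ * σ := by
    rw [_root_.inv_eq_iff_mul_eq_one, ← h4]; simp only [pow_succ, pow_zero, one_mul, mul_assoc]
  let M : Submonoid (SL(2, ℤ) × A) := Submonoid.closure {τ, τ * σ * τ}
  have hMτ : τ ∈ M := Submonoid.subset_closure (by simp)
  have hMl : τ * σ * τ ∈ M := Submonoid.subset_closure (by simp)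
  let N : Set (SL(2, ℤ) × A) := {x | ∃ i j : ℕ, ∃ w ∈ M, x = σ ^ i * w * σ ^ j}
  have hNσ : ∀ x ∈ N, σ * x ∈ N := by
    rintro x ⟨i, j, w, hw, rfl⟩
    exact ⟨i + 1, j, w, hw, by simp only [pow_succ', mul_assoc]⟩
  have hNτ0 : ∀ w ∈ M, ∀ j : ℕ, τ * σ * w * σ ^ j ∈ N := by
    intro w hw j
    induction hw using Submonoid.closure_induction_left with
    | one => exact ⟨0, j + 1, τ, hMτ, by simp [pow_succ', mul_assoc]⟩
    | mul_left x hx y hy ih =>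
      rcases hx with rfl | hx
      · exact ⟨0, j, x * σ * x * y, M.mul_mem hMl hy, by simp [mul_assoc]⟩
      · rw [Set.mem_singleton_iff] at hx
        refine ⟨1, j, y, hy, ?_⟩
        have : τ * σ * (x * y) * σ ^ j = (τ * σ * τ * σ * τ) * y * σ ^ j := by
          rw [hx]; simp only [mul_assoc]
        rw [this, h5, pow_one]
  have hcp : ∀ k : ℕ, τ * σ ^ (2 * k) = σ ^ (2 * k) * τ := by
    intro k; rw [pow_mul]; exact (Commute.pow_right (show Commute τ (σ ^ 2) from hcc) k)
  have hNpow : ∀ (i : ℕ), ∀ x ∈ N, σ ^ i * x ∈ N := by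
    intro i; induction i with
    | zero => intro x hx; simpa using hx
    | succ i ih => intro x hx; rw [pow_succ', mul_assoc]; exact hNσ _ (ih x hx)
  have hNτ : ∀ x ∈ N, τ * x ∈ N := by
    rintro x ⟨i, j, w, hw, rfl⟩
    rcases Nat.even_or_odd' i with ⟨k, rfl | rfl⟩
    · refine ⟨2 * k, j, τ * w, M.mul_mem hMτ hw, ?_⟩
      simp only [← mul_assoc, hcp]
    · have := hNpow (2 * k) _ (hNτ0 w hw j)
      convert this using 1
      simp only [pow_succ, ← mul_assoc, hcp]
  let H : Subgroup (SL(2, ℤ) × A) := Subgroup.closure {σ, τ}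
  have hHN : ∀ x ∈ H, x ∈ N := by
    intro x hx
    induction hx using Subgroup.closure_induction_left with
    | one => exact ⟨0, 0, 1, M.one_mem, by simp⟩
    | mul_left x hx y hy ih =>
      rcases hx with rfl | rfl
      · exact hNσ _ ih
      · exact hNτ _ ih
    | inv_mul_cancel x hx y hy ih =>
      rcases hx with rfl | rfl
      · rw [hσi]; simp only [mul_assoc]; exact hNσ _ (hNσ _ (hNσ _ ih))
      · rw [hτi]; simp only [mul_assoc]
        exact hNσ _ (hNτ _ (hNσ _ (hNτ _ (hNσ _ (hNσ _ (hNσ _ ih))))))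
  have hMpos : ∀ w ∈ M, w = 1 ∨ ((∀ i j, 0 ≤ w.1 i j) ∧
      3 ≤ w.1 0 0 + w.1 0 1 + w.1 1 0 + w.1 1 1 ∧ 0 < w.1 0 0 + w.1 0 1 ∧
      0 < w.1 1 0 + w.1 1 1) := by
    intro w hw
    induction hw using Submonoid.closure_induction_left with
    | one => exact Or.inl rfl
    | mul_left x hx y hy ih =>
      right
      rcases hx with hx | hx
      · rw [hx, hτ]
        rcases ih with rfl | ⟨h0, h3, ha, hb⟩
        · simp [Fin.forall_fin_two]
        · have := h0 0 0; have := h0 0 1; have := h0 1 0; have := h0 1 1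
          simp [Matrix.SpecialLinearGroup.coe_mul, Fin.forall_fin_two, Matrix.mul_apply, Fin.sum_univ_two]
          refine ⟨⟨⟨?_, ?_⟩, ?_, ?_⟩, ?_, ?_, ?_⟩ <;> linarith
      · rw [Set.mem_singleton_iff.1 hx, hτ, hσ]
        rcases ih with rfl | ⟨h0, h3, ha, hb⟩
        · simp [Matrix.SpecialLinearGroup.coe_mul, Fin.forall_fin_two]
        · have := h0 0 0; have := h0 0 1; have := h0 1 0; have := h0 1 1
          simp [Matrix.SpecialLinearGroup.coe_mul, Fin.forall_fin_two, Matrix.mul_apply,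
            Fin.sum_univ_two]
          refine ⟨⟨⟨?_, ?_⟩, ?_, ?_⟩, ?_, ?_, ?_⟩ <;> linarith
  have hS4 : (ModularGroup.S) ^ 4 = 1 := by simpa [hσ] using congrArg Prod.fst h4
  have hSsum : ∀ n : ℕ, n % 4 = 0 ∨ (ModularGroup.S ^ n ≠ 1) := by
    intro n
    by_contra! h
    rw [← Nat.div_add_mod n 4, pow_add, pow_mul, hS4, one_pow, one_mul] at h
    have h2 := h.2
    have hlt := Nat.mod_lt n (show 4 > 0 by norm_num)
    have h1 := h.1
    simp only [Nat.mul_add_mod, Nat.mod_mod] at h1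
    generalize n % 4 = m at h1 h2 hlt
    interval_cases m
    · exact h1 rfl
    all_goals revert h2; decide
  have hSle : ∀ n : ℕ, (ModularGroup.S ^ n) 0 0 + (ModularGroup.S ^ n) 0 1 +
      (ModularGroup.S ^ n) 1 0 + (ModularGroup.S ^ n) 1 1 ≤ 2 := by
    intro n
    rw [← Nat.div_add_mod n 4, pow_add, pow_mul, hS4, one_pow, one_mul]
    have hlt := Nat.mod_lt n (show 4 > 0 by norm_num)
    generalize n % 4 = m at hlt
    interval_cases m <;> decide
  have hker : ∀ x ∈ H, x.1 = 1 → x = 1 := by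
    intro x hx h1
    obtain ⟨i, j, w, hw, rfl⟩ := hHN x hx
    have hw1 : w = 1 := by
      rcases hMpos w hw with h | ⟨-, h3, -⟩
      · exact h
      · exfalso
        have e1 : ModularGroup.S ^ i * w.1 * ModularGroup.S ^ j = 1 := by simpa [hσ] using h1
        have e2 : w.1 = ModularGroup.S ^ (3 * i + 3 * j) := by
          have hi : ∀ k : ℕ, ModularGroup.S ^ (3 * k) * ModularGroup.S ^ k = 1 := fun k => by
            rw [← pow_add, show 3 * k + k = 4 * k by ring, pow_mul, hS4, one_pow]
          have hi' : ∀ k : ℕ, ModularGroup.S ^ k * ModularGroup.S ^ (3 * k) = 1 := fun k => by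
            rw [← pow_add, show k + 3 * k = 4 * k by ring, pow_mul, hS4, one_pow]
          calc w.1 = (ModularGroup.S ^ (3 * i) * ModularGroup.S ^ i) * w.1 *
                (ModularGroup.S ^ j * ModularGroup.S ^ (3 * j)) := by rw [hi, hi']; simp
            _ = ModularGroup.S ^ (3 * i) * (ModularGroup.S ^ i * w.1 * ModularGroup.S ^ j) *
                  ModularGroup.S ^ (3 * j) := by simp only [mul_assoc]
            _ = _ := by rw [e1, mul_one, pow_add]
        have := hSle (3 * i + 3 * j)
        rw [← e2] at this
        linarith
    subst hw1
    rw [mul_one, ← pow_add] at h1 ⊢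
    have h1' : ModularGroup.S ^ (i + j) = 1 := by simpa [hσ] using h1
    rcases hSsum (i + j) with h | h
    · rw [← Nat.div_add_mod (i + j) 4, h, add_zero, pow_mul, h4, one_pow]
    · exact absurd h1' h
  let π : H →* SL(2, ℤ) := (MonoidHom.fst _ _).comp H.subtype
  have hπ : Function.Bijective π := by
    constructor
    · rw [injective_iff_map_eq_one]
      rintro ⟨x, hx⟩ h
      exact Subtype.ext (hker x hx h)
    · rw [← MonoidHom.range_eq_top, MonoidHom.range_comp, Subgroup.range_subtype,
        MonoidHom.map_closure]
      rw [← SpecialLinearGroup.SL2Z_generators, Set.image_pair, hσ, hτ]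
      rfl
  let e := MulEquiv.ofBijective π hπ
  have hσH : σ ∈ H := Subgroup.subset_closure (by simp)
  have hτH : τ ∈ H := Subgroup.subset_closure (by simp)
  have eσ : e.symm ModularGroup.S = ⟨σ, hσH⟩ := by
    rw [MulEquiv.symm_apply_eq]; change _ = σ.1; rw [hσ]
  have eτ : e.symm ModularGroup.T = ⟨τ, hτH⟩ := by
    rw [MulEquiv.symm_apply_eq]; change _ = τ.1; rw [hτ]
  refine ⟨((MonoidHom.snd _ _).comp H.subtype).comp e.symm.toMonoidHom, ?_, ?_⟩
  · change ((e.symm ModularGroup.S : H) : SL(2, ℤ) × A).2 = s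
    rw [eσ]; exact congrArg Prod.snd hσ
  · change ((e.symm ModularGroup.T : H) : SL(2, ℤ) × A).2 = t
    rw [eτ]; exact congrArg Prod.snd hτ

/-! ### Column-finite matrices -/

/-- The space of columns indexed by `ι` with finitely many nonzero entries. Its endomorphisms are
the column-finite matrices. Dirichlet series use `ι = ℕ+`; the auxiliary matrices of the
construction are indexed by `ι = ℕ`, starting at `0` instead of `1`. -/
abbrev Col (ι : Type) := ι →₀ ℂ

/-- The column-finite matrix with given columns. -/
def ofCols {ι : Type} (c : ι → Col ι) : Module.End ℂ (Col ι) := Finsupp.linearCombination ℂ c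

/-- The `(i, j)` entry of a column-finite matrix. -/
def entry {ι : Type} (A : Module.End ℂ (Col ι)) (i j : ι) : ℂ := A (Finsupp.single j 1) i

@[simp] lemma ofCols_single {ι : Type} (c : ι → Col ι) (j : ι) (a : ℂ) :
    ofCols c (Finsupp.single j a) = a • c j := by simp [ofCols]

/-- Column `2 c + b` of the block upper triangular Toeplitz matrix attached to `X`. -/
def toeplitzCol (X : Matrix (Fin 2) (Fin 2) ℂ⟦X⟧) (c : ℕ) (b : Fin 2) : Col ℕ :=
  ∑ p ∈ Finset.HasAntidiagonal.antidiagonal c, ∑ a : Fin 2,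
    Finsupp.single (2 * p.1 + (a : ℕ)) (coeff p.2 (X a b))

/-- The block upper triangular matrix with `2 × 2` blocks whose block in position `(r, c)`, `r ≤ c`,
is the coefficient of `t ^ (c - r)` in `X`. -/
def toeplitzFun (X : Matrix (Fin 2) (Fin 2) ℂ⟦X⟧) : Module.End ℂ (Col ℕ) :=
  ofCols fun j => toeplitzCol X (j / 2) (Fin.ofNat 2 j)

lemma toeplitzFun_single (X : Matrix (Fin 2) (Fin 2) ℂ⟦X⟧) (c : ℕ) (b : Fin 2) (z : ℂ) :
    toeplitzFun X (Finsupp.single (2 * c + (b : ℕ)) z) = z • toeplitzCol X c b := by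
  have h1 : (2 * c + (b : ℕ)) / 2 = c := by omega
  have h2 : Fin.ofNat 2 (2 * c + (b : ℕ)) = b := by
    apply Fin.ext; simp [Fin.ofNat]; omega
  rw [toeplitzFun, ofCols_single, h1, h2]

lemma end_ext {f g : Module.End ℂ (Col ℕ)}
    (h : ∀ (c : ℕ) (b : Fin 2), f (Finsupp.single (2 * c + (b : ℕ)) 1) =
      g (Finsupp.single (2 * c + (b : ℕ)) 1)) : f = g := by
  ext1 j
  ext1
  have := h (j / 2) ⟨j % 2, Nat.mod_lt _ two_pos⟩
  simpa [Nat.div_add_mod] using this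

lemma sum_antidiagonal_assoc {M : Type*} [AddCommMonoid M] (F : ℕ → ℕ → ℕ → M) (n : ℕ) :
    ∑ p ∈ Finset.HasAntidiagonal.antidiagonal n, ∑ q ∈ Finset.HasAntidiagonal.antidiagonal p.2,
      F p.1 q.1 q.2 =
    ∑ p ∈ Finset.HasAntidiagonal.antidiagonal n, ∑ q ∈ Finset.HasAntidiagonal.antidiagonal p.1,
      F q.1 q.2 p.2 := by
  rw [Finset.sum_sigma', Finset.sum_sigma']
  refine Finset.sum_nbij' (fun x : (_ : ℕ × ℕ) × ℕ × ℕ => ⟨(x.1.1 + x.2.1, x.2.2), (x.1.1, x.2.1)⟩)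
    (fun x : (_ : ℕ × ℕ) × ℕ × ℕ => ⟨(x.2.1, x.2.2 + x.1.2), (x.2.2, x.1.2)⟩) ?_ ?_ ?_ ?_ ?_
  · rintro ⟨⟨a, b⟩, ⟨d, e⟩⟩ h; simp at h ⊢; omega
  · rintro ⟨⟨a, b⟩, ⟨d, e⟩⟩ h; simp at h ⊢; omega
  · rintro ⟨⟨a, b⟩, ⟨d, e⟩⟩ h; simp at h ⊢; exact h.2
  · rintro ⟨⟨a, b⟩, ⟨d, e⟩⟩ h; simp at h ⊢; exact h.2
  · rintro ⟨⟨a, b⟩, ⟨d, e⟩⟩ h; rfl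

/-- `toeplitzFun` is a ring homomorphism (the inverse of the isomorphism `γ`). -/
def toeplitz : Matrix (Fin 2) (Fin 2) ℂ⟦X⟧ →+* Module.End ℂ (Col ℕ) where
  toFun := toeplitzFun
  map_one' := by
    apply end_ext
    intro c b
    rw [toeplitzFun_single, one_smul, toeplitzCol, Finset.sum_eq_single (c, 0)]
    · rw [Finset.sum_eq_single b] <;> simp +contextual
    · rintro ⟨p, q⟩ hp hne
      have hq : q ≠ 0 := by
        rintro rfl; apply hne; simpa using hp
      apply Finset.sum_eq_zero
      intro a _
      simp [Matrix.one_apply, apply_ite, PowerSeries.coeff_one, hq]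
    · simp
  map_zero' := by
    apply end_ext; intro c b
    rw [toeplitzFun_single]; simp [toeplitzCol]
  map_add' X Y := by
    apply end_ext; intro c b
    simp [toeplitzFun_single, toeplitzCol, Finset.sum_add_distrib]
  map_mul' X Y := by
    apply end_ext; intro c b
    rw [Module.End.mul_apply, toeplitzFun_single, toeplitzFun_single, one_smul, one_smul]
    have hY : toeplitzFun X (toeplitzCol Y c b) = ∑ p ∈ Finset.HasAntidiagonal.antidiagonal c, ∑ d : Fin 2,
        coeff p.2 (Y d b) • toeplitzCol X p.1 d := by
      simp only [toeplitzCol, map_sum, toeplitzFun_single]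
    rw [hY]
    have hL : toeplitzCol (X * Y) c b = ∑ p ∈ Finset.HasAntidiagonal.antidiagonal c,
        ∑ q ∈ Finset.HasAntidiagonal.antidiagonal p.2, ∑ a : Fin 2, ∑ d : Fin 2,
          Finsupp.single (2 * p.1 + (a : ℕ)) (coeff q.1 (X a d) * coeff q.2 (Y d b)) := by
      simp only [toeplitzCol, Matrix.mul_apply, map_sum, PowerSeries.coeff_mul,
        Finsupp.single_finsetSum]
      refine Finset.sum_congr rfl fun p _ => ?_
      rw [Finset.sum_comm]
      conv_rhs => rw [Finset.sum_comm]
      rw [Finset.sum_comm]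
      exact Finset.sum_congr rfl fun a _ => Finset.sum_comm
    have hR : (∑ p ∈ Finset.HasAntidiagonal.antidiagonal c, ∑ d : Fin 2,
        coeff p.2 (Y d b) • toeplitzCol X p.1 d) = ∑ p ∈ Finset.HasAntidiagonal.antidiagonal c,
        ∑ q ∈ Finset.HasAntidiagonal.antidiagonal p.1, ∑ a : Fin 2, ∑ d : Fin 2,
          Finsupp.single (2 * q.1 + (a : ℕ)) (coeff q.2 (X a d) * coeff p.2 (Y d b)) := by
      simp only [toeplitzCol, Finset.smul_sum, Finsupp.smul_single, smul_eq_mul]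
      refine Finset.sum_congr rfl fun p _ => ?_
      rw [Finset.sum_comm]
      refine Finset.sum_congr rfl fun q _ => ?_
      rw [Finset.sum_comm]
      simp only [mul_comm]
    rw [hL, hR]
    exact sum_antidiagonal_assoc (fun i j k => ∑ a : Fin 2, ∑ d : Fin 2,
      Finsupp.single (2 * i + (a : ℕ)) (coeff j (X a d) * coeff k (Y d b))) c

/-- `b_0 = b_1 = 1` and `b_n + ∑_{i + j = n, i, j ≥ 1} b_i b_j = 0` for `n ≥ 2`. -/
def bSeq : ℕ → ℤ
  | 0 => 1
  | 1 => 1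
  | n + 2 => -∑ i : Fin (n + 1), bSeq (i + 1) * bSeq (n + 1 - i)

/-! ### The series `g(t)` and the representation `τ₁`. -/

/-- `1 + g(t) = ∑ b_k t ^ k`. -/
def gSeries : ℂ⟦X⟧ := PowerSeries.mk fun n => if n = 0 then 0 else (bSeq n : ℂ)

lemma gSeries_sq_add : gSeries ^ 2 + gSeries = X := by
  ext n
  rw [map_add, pow_two, PowerSeries.coeff_mul, PowerSeries.coeff_X]
  simp only [gSeries, PowerSeries.coeff_mk]
  match n with
  | 0 => simp
  | 1 => simp [Finset.Nat.antidiagonal_succ, bSeq]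
  | n + 2 =>
    rw [Finset.Nat.sum_antidiagonal_succ, Finset.Nat.sum_antidiagonal_succ']
    have h : bSeq (n + 2) = -∑ p ∈ Finset.HasAntidiagonal.antidiagonal n,
        bSeq (p.1 + 1) * bSeq (p.2 + 1) := by
      rw [bSeq, Finset.Nat.sum_antidiagonal_eq_sum_range_succ_mk, Finset.sum_range]
      refine congrArg _ (Finset.sum_congr rfl fun i _ => ?_)
      rw [show n + 1 - (i : ℕ) = n - i + 1 by omega]
    simp [h]

/-- The matrix of power series with coefficients `B 0, B 1, ...`. -/
def blockMatrix (B : ℕ → Matrix (Fin 2) (Fin 2) ℂ) : Matrix (Fin 2) (Fin 2) ℂ⟦X⟧ :=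
  Matrix.of fun i j => PowerSeries.mk fun n => B n i j

/-- The blocks `B_0 = T`, `B_1`, and `B_n`. -/
def jBlock : ℕ → Matrix (Fin 2) (Fin 2) ℂ
  | 0 => !![1, 1; 0, 1]
  | 1 => !![0, 1; 1, 1]
  | n + 2 => !![0, (bSeq (n + 2) : ℂ); (bSeq (n + 2) : ℂ), 0]

/-- The blocks of `diag(S, S, ...)`. -/
def sBlock : ℕ → Matrix (Fin 2) (Fin 2) ℂ
  | 0 => !![0, -1; 1, 0]
  | _ + 1 => 0

lemma blockMatrix_jBlock : blockMatrix jBlock = !![1, 1 + gSeries; gSeries, 1 + X] := by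
  ext i j n
  match n with
  | 0 => fin_cases i <;> fin_cases j <;> simp [blockMatrix, jBlock, gSeries]
  | 1 => fin_cases i <;> fin_cases j <;>
      simp [blockMatrix, jBlock, gSeries, bSeq, PowerSeries.coeff_one, PowerSeries.coeff_X]
  | n + 2 => fin_cases i <;> fin_cases j <;>
      simp [blockMatrix, jBlock, gSeries, PowerSeries.coeff_one, PowerSeries.coeff_X]

lemma blockMatrix_sBlock : blockMatrix sBlock = !![0, -1; 1, 0] := by
  ext i j n
  match n with
  | 0 => fin_cases i <;> fin_cases j <;> simp [blockMatrix, sBlock]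
  | n + 1 => fin_cases i <;> fin_cases j <;>
      simp [blockMatrix, sBlock, PowerSeries.coeff_one]

/-- The matrix `J̃`, with block `B_{c - r}` in position `(r, c)`. -/
def Jt : Module.End ℂ (Col ℕ) := toeplitz (blockMatrix jBlock)
/-- The matrix `S̃ = diag(S, S, ...)`. -/
def St : Module.End ℂ (Col ℕ) := toeplitz (blockMatrix sBlock)

lemma St_sq : St * St + 1 = 0 := by
  rw [St, ← map_mul, blockMatrix_sBlock, ← map_one toeplitz, ← map_add, ← map_zero toeplitz]
  congr 1
  ext i j n; fin_cases i <;> fin_cases j <;> simp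

lemma St_Jt_cube : (St * Jt) ^ 3 + 1 = 0 := by
  have hg := gSeries_sq_add
  rw [St, Jt, ← map_mul, ← map_pow, blockMatrix_sBlock, blockMatrix_jBlock, ← map_one toeplitz,
    ← map_add, ← map_zero toeplitz]
  congr 1
  rw [pow_succ, pow_two, ← hg]
  ext1 i j
  fin_cases i <;> fin_cases j <;> simp <;> ring

lemma exists_hom_of_relations {R : Type*} [Ring R] (s t : R) (h2 : s * s + 1 = 0)
    (h3 : (s * t) ^ 3 + 1 = 0) :
    ∃ f : SL(2, ℤ) →* Rˣ, (f ModularGroup.S : R) = s ∧ (f ModularGroup.T : R) = t := by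
  have h2' : s * s = -1 := eq_neg_of_add_eq_zero_left h2
  have h3' : (s * t) ^ 3 = -1 := eq_neg_of_add_eq_zero_left h3
  let u : Rˣ := ⟨s, -s, by rw [mul_neg, h2', neg_neg], by rw [neg_mul, h2', neg_neg]⟩
  have h : IsUnit (s * t) := by
    have : IsUnit ((s * t) ^ 3) := by rw [h3']; exact isUnit_one.neg
    exact (isUnit_pow_iff (by norm_num)).1 this
  have ht : IsUnit t := by
    have e : t = (u⁻¹ : Rˣ) * (s * t) := by
      change t = -s * (s * t)
      rw [← mul_assoc, neg_mul, h2', neg_neg, one_mul]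
    rw [e]
    exact (u⁻¹).isUnit.mul h
  have hu : u ^ 2 = -1 := by
    ext1; rw [pow_two]; exact h2'
  obtain ⟨f, hf1, hf2⟩ := exists_hom_SL2Z u ht.unit
    (by rw [show 4 = 2 * 2 by rfl, pow_mul, hu]; simp)
    (by rw [hu]; ext1; exact h3') (by rw [hu]; simp)
  exact ⟨f, by rw [hf1], by rw [hf2]; rfl⟩

lemma exists_tau1 : ∃ f : SL(2, ℤ) →* (Module.End ℂ (Col ℕ))ˣ,
    (f ModularGroup.S : Module.End ℂ (Col ℕ)) = St ∧
    (f ModularGroup.T : Module.End ℂ (Col ℕ)) = Jt :=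
  exists_hom_of_relations St Jt St_sq St_Jt_cube

/-- The representation `τ₁` with `τ₁(S) = S̃` and `τ₁(T) = J̃`. -/
def tau1 : SL(2, ℤ) →* (Module.End ℂ (Col ℕ))ˣ := exists_tau1.choose

lemma tau1_S : (tau1 ModularGroup.S : Module.End ℂ (Col ℕ)) = St := exists_tau1.choose_spec.1
lemma tau1_T : (tau1 ModularGroup.T : Module.End ℂ (Col ℕ)) = Jt := exists_tau1.choose_spec.2

/-! ### Unitriangular matrices are invertible -/

lemma entry_mul {ι : Type} (A B : Module.End ℂ (Col ι)) (i j : ι) :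
    entry (A * B) i j = (B (Finsupp.single j 1)).sum fun k z => z * entry A i k := by
  have h : ∀ v : Col ι, (A v) i = v.sum fun k z => z * entry A i k := by
    intro v
    conv_lhs => rw [← Finsupp.sum_single v]
    rw [map_finsuppSum, Finsupp.sum_apply]
    refine Finsupp.sum_congr fun k _ => ?_
    rw [← mul_one (v k), ← smul_eq_mul, ← Finsupp.smul_single, map_smul]
    simp [entry]
  exact h _

lemma entry_add {ι : Type} (A B : Module.End ℂ (Col ι)) (i j : ι) :
    entry (A + B) i j = entry A i j + entry B i j := rfl

lemma entry_sub {ι : Type} (A B : Module.End ℂ (Col ι)) (i j : ι) :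
    entry (A - B) i j = entry A i j - entry B i j := rfl

lemma entry_one {ι : Type} [DecidableEq ι] (i j : ι) :
    entry (1 : Module.End ℂ (Col ι)) i j = if i = j then 1 else 0 := by
  simp [entry, Finsupp.single_apply, eq_comm]

lemma isUnit_of_unitriangular {ι : Type} [LinearOrder ι] [WellFoundedLT ι]
    (A : Module.End ℂ (Col ι)) (h1 : ∀ j, entry A j j = 1)
    (h0 : ∀ i j, j < i → entry A i j = 0) : IsUnit A := by
  rw [Module.End.isUnit_iff]
  constructor
  · rw [injective_iff_map_eq_zero]
    intro f hf
    by_contra hne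
    have hs : f.support.Nonempty := Finsupp.support_nonempty_iff.2 hne
    let m := f.support.max' hs
    have hm : m ∈ f.support := Finset.max'_mem _ _
    have : (A f) m = f m := by
      conv_lhs => rw [← Finsupp.sum_single f]
      rw [map_finsuppSum, Finsupp.sum_apply, Finsupp.sum, Finset.sum_eq_single m]
      · have := h1 m
        rw [← mul_one (f m), ← smul_eq_mul, ← Finsupp.smul_single, map_smul, Finsupp.smul_apply]
        simp only [entry] at this
        rw [this]
      · intro k hk hkm
        have hlt : k < m := lt_of_le_of_ne (Finset.le_max' _ _ hk) hkm
        have := h0 m k hlt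
        rw [← mul_one (f k), ← smul_eq_mul, ← Finsupp.smul_single, map_smul, Finsupp.smul_apply]
        simp only [entry] at this
        rw [this, smul_zero]
      · intro h; exact absurd hm h
    rw [hf] at this
    exact Finsupp.mem_support_iff.1 hm this.symm
  · have hj : ∀ j, Finsupp.single j (1 : ℂ) ∈ LinearMap.range A := by
      intro j
      induction j using WellFoundedLT.induction with
      | ind j ih =>
      have hd : A (Finsupp.single j 1) - Finsupp.single j 1 ∈ LinearMap.range A := by
        rw [← Finsupp.sum_single (A (Finsupp.single j 1) - Finsupp.single j 1)]
        refine Submodule.sum_mem _ fun i hi => ?_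
        have hij : i < j := by
          rw [Finsupp.mem_support_iff] at hi
          rcases lt_trichotomy i j with h | h | h
          · exact h
          · exfalso; apply hi; subst h
            have := h1 i
            simp only [entry] at this
            simp [this]
          · exfalso; apply hi
            have := h0 i j h
            simp only [entry] at this
            simp [this, h.ne]
        have := (LinearMap.range A).smul_mem
          ((A (Finsupp.single j 1) - Finsupp.single j 1 : Col ι) i) (ih i hij)
        rwa [Finsupp.smul_single, smul_eq_mul, mul_one] at this
      have := (LinearMap.range A).sub_mem (LinearMap.mem_range_self A (Finsupp.single j 1)) hd
      rwa [sub_sub_cancel] at this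
    rw [← LinearMap.range_eq_top, eq_top_iff]
    intro v _
    rw [← Finsupp.sum_single v]
    refine Submodule.sum_mem _ fun i _ => ?_
    have := (LinearMap.range A).smul_mem (v i) (hj i)
    rwa [Finsupp.smul_single, smul_eq_mul, mul_one] at this

/-! ### The matrix `P` bringing `J̃` to Jordan form -/

lemma toeplitzCol_apply (X : Matrix (Fin 2) (Fin 2) ℂ⟦X⟧) (c r : ℕ) (b a : Fin 2) :
    toeplitzCol X c b (2 * r + (a : ℕ)) = if r ≤ c then coeff (c - r) (X a b) else 0 := by
  rw [toeplitzCol, Finsupp.finsetSum_apply]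
  have key : ∀ p : ℕ × ℕ, (∑ a' : Fin 2, Finsupp.single (2 * p.1 + (a' : ℕ))
      (coeff p.2 (X a' b)) : Col ℕ) (2 * r + (a : ℕ)) =
      if p.1 = r then coeff p.2 (X a b) else 0 := by
    intro p
    have h : ∀ a' : Fin 2, (2 * p.1 + (a' : ℕ) = 2 * r + (a : ℕ)) ↔ (p.1 = r ∧ a' = a) := by
      intro a'
      have := a'.2; have := a.2
      rw [Fin.ext_iff]; omega
    rw [Finsupp.finsetSum_apply]
    simp only [Finsupp.single_apply, h]
    split_ifs with hp
    · simp [hp]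
    · simp [hp]
  simp only [key]
  split_ifs with hrc
  · rw [Finset.sum_eq_single (r, c - r)]
    · simp
    · rintro ⟨p, q⟩ hp hne
      rw [Finset.HasAntidiagonal.mem_antidiagonal] at hp
      simp only at hp ⊢
      rw [if_neg]
      rintro rfl
      apply hne; ext <;> simp; omega
    · intro h; exfalso; apply h
      rw [Finset.HasAntidiagonal.mem_antidiagonal]; simp [hrc]
  · apply Finset.sum_eq_zero
    rintro ⟨p, q⟩ hp
    rw [Finset.HasAntidiagonal.mem_antidiagonal] at hp
    simp only at hp ⊢
    rw [if_neg]; omega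

lemma entry_toeplitz (X : Matrix (Fin 2) (Fin 2) ℂ⟦X⟧) (r c : ℕ) (a b : Fin 2) :
    entry (toeplitz X) (2 * r + (a : ℕ)) (2 * c + (b : ℕ)) =
      if r ≤ c then coeff (c - r) (X a b) else 0 := by
  change toeplitzFun X (Finsupp.single (2 * c + (b : ℕ)) 1) _ = _
  rw [toeplitzFun_single, one_smul, toeplitzCol_apply]

lemma Jt_sub_one : Jt - 1 = toeplitz !![0, 1 + gSeries; gSeries, X] := by
  refine (sub_eq_iff_eq_add (G := Module.End ℂ (Col ℕ))).2 ?_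
  rw [Jt, blockMatrix_jBlock, ← map_one toeplitz, ← map_add]
  congr 1
  ext i j n; fin_cases i <;> fin_cases j <;> simp [add_comm]

lemma exists_fin_two (j : ℕ) : ∃ (c : ℕ) (b : Fin 2), j = 2 * c + (b : ℕ) :=
  ⟨j / 2, ⟨j % 2, Nat.mod_lt _ two_pos⟩, by simp [Nat.div_add_mod]⟩

lemma entry_Jt_sub_one_of_le {i j : ℕ} (h : j ≤ i) : entry (Jt - 1) i j = 0 := by
  obtain ⟨r, a, rfl⟩ := exists_fin_two i
  obtain ⟨c, b, rfl⟩ := exists_fin_two j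
  rw [Jt_sub_one, entry_toeplitz]
  split_ifs with hrc
  · obtain rfl : r = c := by have := a.2; omega
    rw [Nat.sub_self]
    fin_cases a <;> fin_cases b <;> simp [gSeries] at h ⊢
  · rfl

lemma entry_Jt_sub_one_succ (i : ℕ) : entry (Jt - 1) i (i + 1) = 1 := by
  obtain ⟨r, a, rfl⟩ := exists_fin_two i
  rw [Jt_sub_one]
  fin_cases a
  · rw [show 2 * r + ((⟨0, by norm_num⟩ : Fin 2) : ℕ) + 1 = 2 * r + ((1 : Fin 2) : ℕ) by simp,
      entry_toeplitz]
    simp [gSeries]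
  · rw [show 2 * r + ((⟨1, by norm_num⟩ : Fin 2) : ℕ) + 1 = 2 * (r + 1) + ((0 : Fin 2) : ℕ) by
      simp; ring, entry_toeplitz]
    simp [gSeries, bSeq]

lemma entry_pow_eq_zero (n : ℕ) : ∀ i j : ℕ, j < i + n → entry ((Jt - 1) ^ n) i j = 0 := by
  induction n with
  | zero =>
    intro i j h
    rw [pow_zero, entry_one, if_neg (by omega)]
  | succ n ih =>
    intro i j h
    rw [pow_succ, entry_mul]
    refine Finset.sum_eq_zero fun k hk => ?_
    have hkj : k < j := by
      by_contra hle
      exact Finsupp.mem_support_iff.1 hk (entry_Jt_sub_one_of_le (not_lt.1 hle))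
    simp only
    rw [ih i k (by omega), mul_zero]

lemma entry_pow_eq_one (n : ℕ) : ∀ i : ℕ, entry ((Jt - 1) ^ n) i (i + n) = 1 := by
  induction n with
  | zero => intro i; rw [pow_zero, entry_one, if_pos (by simp)]
  | succ n ih =>
    intro i
    rw [pow_succ, entry_mul, Finsupp.sum, Finset.sum_eq_single (i + n)]
    · rw [ih, mul_one]
      exact entry_Jt_sub_one_succ (i + n)
    · intro k hk hne
      have hkj : k < i + (n + 1) := by
        by_contra hle
        exact Finsupp.mem_support_iff.1 hk (entry_Jt_sub_one_of_le (not_lt.1 hle))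
      rw [entry_pow_eq_zero n i k (by omega), mul_zero]
    · intro h
      have := entry_Jt_sub_one_succ (i + n)
      rw [Finsupp.notMem_support_iff] at h
      change entry (Jt - 1) (i + n) (i + n + 1) = 0 at h
      rw [this] at h
      exact absurd h one_ne_zero

/-- The upper unitriangular matrix whose row `n` (counted from `0`) is the first row of
`(J̃ - 1) ^ n`; see `entry_P`. -/
def P : Module.End ℂ (Col ℕ) :=
  ofCols fun j => Finsupp.onFinset (Finset.range (j + 1)) (fun n => entry ((Jt - 1) ^ n) 0 j)
    fun n hn => by
      by_contra h
      rw [Finset.mem_range] at h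
      exact hn (entry_pow_eq_zero n 0 j (by omega))

lemma entry_P (n j : ℕ) : entry P n j = entry ((Jt - 1) ^ n) 0 j := by
  rw [entry, P, ofCols_single, one_smul, Finsupp.onFinset_apply]

lemma isUnit_P : IsUnit P :=
  isUnit_of_unitriangular P
    (fun j => by rw [entry_P]; simpa using entry_pow_eq_one j 0)
    (fun i j h => by rw [entry_P]; exact entry_pow_eq_zero i 0 j (by omega))

/-! ### The divisor matrix `D`, the matrix `Z`, and the representation `ρ` -/

/-- The divisor matrix; see `entry_D`. -/
def D : Module.End ℂ (Col ℕ+) :=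
  ofCols fun j => ∑ i ∈ (Finset.Icc 1 j).filter (fun i : ℕ+ => (i : ℕ) ∣ j), Finsupp.single i 1

lemma entry_D (i j : ℕ+) : entry D i j = if (i : ℕ) ∣ j then 1 else 0 := by
  rw [entry, D, ofCols_single, one_smul, Finsupp.finsetSum_apply]
  simp only [Finsupp.single_apply]
  rw [Finset.sum_ite_eq']
  simp only [Finset.mem_filter, Finset.mem_Icc, one_le, true_and]
  refine if_congr ⟨fun h => h.2, fun h => ⟨Nat.le_of_dvd j.pos h, h⟩⟩ rfl rfl

/-- The exponent of `2` in `n`. -/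
def val2 (n : ℕ+) : ℕ := (n : ℕ).factorization 2

/-- The odd number `d` with `n = 2 ^ k * d`. -/
def oddPart (n : ℕ+) : ℕ+ :=
  ⟨(n : ℕ) / 2 ^ (n : ℕ).factorization 2, Nat.ordCompl_pos 2 n.ne_zero⟩

lemma pow_mul_oddPart (n : ℕ+) : 2 ^ val2 n * oddPart n = n := by
  apply PNat.eq
  rw [PNat.mul_coe, PNat.pow_coe]
  exact Nat.ordProj_mul_ordCompl_eq_self (n : ℕ) 2

lemma oddPart_pow_mul (k : ℕ) (n : ℕ+) : oddPart (2 ^ k * oddPart n) = oddPart n := by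
  apply PNat.eq
  have h : ¬ 2 ∣ (n : ℕ) / 2 ^ (n : ℕ).factorization 2 :=
    Nat.not_dvd_ordCompl Nat.prime_two n.ne_zero
  change (((2 ^ k * oddPart n : ℕ+) : ℕ)) / 2 ^ (((2 ^ k * oddPart n : ℕ+) : ℕ)).factorization 2 = _
  rw [PNat.mul_coe, PNat.pow_coe]
  exact Nat.ordCompl_pow_mul_of_not_dvd k Nat.prime_two h

lemma val2_pow_mul (k : ℕ) (n : ℕ+) : val2 (2 ^ k * oddPart n) = k := by
  have h1 := pow_mul_oddPart (2 ^ k * oddPart n)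
  rw [oddPart_pow_mul] at h1
  have h2 := mul_right_cancel h1
  have h3 := congrArg (fun x : ℕ+ => (x : ℕ)) h2
  simp only [PNat.pow_coe] at h3
  exact Nat.pow_right_injective le_rfl h3

lemma entry_D_sub_one (i j : ℕ+) :
    entry (D - 1) i j = if (i : ℕ) ∣ j ∧ i ≠ j then 1 else 0 := by
  rw [entry_sub, entry_D, entry_one]
  by_cases h : i = j
  · simp [h]
  · simp [h]

lemma two_mul_le_of_entry {i j : ℕ+} (h : entry (D - 1) i j ≠ 0) : 2 * i ≤ j := by
  rw [entry_D_sub_one] at h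
  have h' : (i : ℕ) ∣ j ∧ i ≠ j := by by_contra hc; exact h (if_neg hc)
  obtain ⟨hd, hne⟩ := h'
  obtain ⟨c, rfl⟩ := PNat.dvd_iff.2 hd
  rw [mul_comm]
  refine mul_le_mul_right ?_ i
  have : c ≠ 1 := by rintro rfl; simp at hne
  have h1 : (1 : ℕ+) < c := lt_of_le_of_ne one_le (Ne.symm this)
  exact PNat.add_one_le_iff.2 h1

lemma le_of_entry_D_pow (k : ℕ) : ∀ d j : ℕ+, entry ((D - 1) ^ k) d j ≠ 0 → 2 ^ k * d ≤ j := by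
  induction k with
  | zero =>
    intro d j h
    rw [pow_zero, entry_one] at h
    have : d = j := by by_contra hc; exact h (if_neg hc)
    simp [this]
  | succ k ih =>
    intro d j h
    rw [pow_succ, entry_mul] at h
    obtain ⟨i, hi, hne⟩ := Finset.exists_ne_zero_of_sum_ne_zero h
    have h1 := two_mul_le_of_entry (i := i) (j := j) (Finsupp.mem_support_iff.1 hi)
    have h2 := ih d i (right_ne_zero_of_mul hne)
    calc 2 ^ (k + 1) * d = 2 * (2 ^ k * d) := by rw [pow_succ', mul_assoc]
      _ ≤ 2 * i := by gcongr
      _ ≤ j := h1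

lemma entry_D_pow_self (k : ℕ) (d : ℕ+) : entry ((D - 1) ^ k) d (2 ^ k * d) = 1 := by
  induction k with
  | zero => rw [pow_zero, entry_one]; simp
  | succ k ih =>
    have hone : entry (D - 1) (2 ^ k * d) (2 ^ (k + 1) * d) = 1 := by
      rw [entry_D_sub_one, if_pos]
      refine ⟨PNat.dvd_iff.1 ⟨2, by rw [pow_succ]; ring⟩, fun h => ?_⟩
      have h2 := congrArg (fun x : ℕ+ => (x : ℕ)) (mul_right_cancel h)
      simp only [PNat.pow_coe] at h2
      have := Nat.pow_right_injective le_rfl h2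
      omega
    rw [pow_succ, entry_mul, Finsupp.sum, Finset.sum_eq_single (2 ^ k * d)]
    · rw [ih, mul_one]
      exact hone
    · intro i hi hne
      have h1 := two_mul_le_of_entry (i := i) (j := 2 ^ (k + 1) * d) (Finsupp.mem_support_iff.1 hi)
      by_contra hc
      have h2 := le_of_entry_D_pow k d i (right_ne_zero_of_mul hc)
      apply hne
      refine le_antisymm ?_ h2
      rw [pow_succ', mul_assoc] at h1
      exact le_of_mul_le_mul_left' h1
    · intro h
      rw [Finsupp.notMem_support_iff] at h
      change entry (D - 1) (2 ^ k * d) (2 ^ (k + 1) * d) = 0 at h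
      rw [hone] at h
      exact absurd h one_ne_zero

/-- The upper unitriangular matrix whose row `2 ^ k * d`, `d` odd, is row `d` of `(D - 1) ^ k`;
see `entry_Z`. -/
def Z : Module.End ℂ (Col ℕ+) :=
  ofCols fun j => Finsupp.onFinset (Finset.Icc 1 j)
    (fun i => entry ((D - 1) ^ val2 i) (oddPart i) j)
    fun i hi => by
      have := le_of_entry_D_pow _ _ _ hi
      rw [pow_mul_oddPart] at this
      exact Finset.mem_Icc.2 ⟨one_le, this⟩

lemma entry_Z (i j : ℕ+) : entry Z i j = entry ((D - 1) ^ val2 i) (oddPart i) j := by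
  rw [entry, Z, ofCols_single, one_smul, Finsupp.onFinset_apply]

lemma isUnit_Z : IsUnit Z :=
  isUnit_of_unitriangular Z
    (fun j => by
      rw [entry_Z]
      conv_lhs => rw [← pow_mul_oddPart j]
      rw [val2_pow_mul, oddPart_pow_mul]
      exact entry_D_pow_self _ _)
    (fun i j h => by
      rw [entry_Z]
      by_contra hc
      have := le_of_entry_D_pow _ _ _ hc
      rw [pow_mul_oddPart] at this
      exact absurd h (not_lt.2 this))

/-- The map `e_k ↦ e_{2 ^ k * d}`, where `d` is the odd part of `n`. -/
def strand (n : ℕ+) : Col ℕ →ₗ[ℂ] Col ℕ+ :=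
  Finsupp.lmapDomain ℂ ℂ fun k => 2 ^ k * oddPart n

/-- The matrix with entry `A_{k, l}` in position `(2 ^ k * d, 2 ^ l * d)` for all odd `d`, and zeros
elsewhere. -/
def psiFun (A : Module.End ℂ (Col ℕ)) : Module.End ℂ (Col ℕ+) :=
  ofCols fun n => strand n (A (Finsupp.single (val2 n) 1))

lemma psiFun_strand (A : Module.End ℂ (Col ℕ)) (n : ℕ+) (v : Col ℕ) :
    psiFun A (strand n v) = strand n (A v) := by
  have : psiFun A ∘ₗ strand n = strand n ∘ₗ A := by
    ext1 k
    ext1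
    simp only [LinearMap.comp_apply, Finsupp.lsingle_apply]
    rw [strand, Finsupp.lmapDomain_apply, Finsupp.mapDomain_single, psiFun, ofCols_single,
      one_smul, val2_pow_mul, strand, oddPart_pow_mul]
  exact LinearMap.congr_fun this v

/-- `psiFun` is a ring homomorphism. -/
def psi : Module.End ℂ (Col ℕ) →+* Module.End ℂ (Col ℕ+) where
  toFun := psiFun
  map_one' := by
    ext1 n; ext1
    simp [psiFun, strand, pow_mul_oddPart]
  map_zero' := by
    ext1 n; ext1
    simp [psiFun]
  map_add' A B := by
    ext1 n; ext1
    simp [psiFun]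
  map_mul' A B := by
    ext1 n; ext1
    simp only [LinearMap.comp_apply, Finsupp.lsingle_apply, Module.End.mul_apply]
    rw [psiFun, ofCols_single, one_smul, Module.End.mul_apply, ← psiFun_strand]
    congr 1
    rw [psiFun, ofCols_single, one_smul]

/-- The representation `ρ(Y) = Z⁻¹ ψ(P τ₁(Y) P⁻¹) Z`. -/
def rho : SL(2, ℤ) →* (Module.End ℂ (Col ℕ+))ˣ :=
  (MulAut.conj isUnit_Z.unit⁻¹).toMonoidHom.comp
    ((Units.map psi.toMonoidHom).comp ((MulAut.conj isUnit_P.unit).toMonoidHom.comp tau1))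

end Representation

section Dirichlet

open Filter Topology

/-! ### Dirichlet series and the right action of matrices on them -/

/-- The right action `(f A)(n) = ∑ m, a_{m,n} f(m)` of column-finite matrices on sequences. A
sequence `f` is identified with the Dirichlet series `∑ f(n) n ^ (-s)`. -/
def act (f : ℕ+ → ℂ) (A : Module.End ℂ (Col ℕ+)) : ℕ+ → ℂ :=
  fun n => (A (Finsupp.single n 1)).sum fun m z => z * f m

/-- The orbit of `f` under `SL(2, ℤ)`, acting through `rho`. -/
def orbit (f : ℕ+ → ℂ) : Set (ℕ+ → ℂ) :=
  Set.range fun Y : Matrix.SpecialLinearGroup (Fin 2) ℤ => act f (rho Y)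

/-- The Dirichlet series `1`, with the single term `1 ^ (-s)`. -/
def oneSeries : ℕ+ → ℂ := fun n => if n = 1 then 1 else 0

/-- The Dirichlet series `∑ n ^ (-s)`. -/
def zetaSeries : ℕ+ → ℂ := fun _ => 1

/-- The Dirichlet series `φ = 1.ρ(-S)`. -/
def phiSeries : ℕ+ → ℂ := act oneSeries (rho (-ModularGroup.S))

/-- The partial sums `∑_{n = 1}^{N} f(n) n ^ (-s)`. -/
def partialSum (f : ℕ+ → ℂ) (s : ℂ) (N : ℕ) : ℂ :=
  ∑ n ∈ Finset.range N, f n.succPNat * ((n + 1 : ℕ) : ℂ) ^ (-s)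

/-- (Possibly conditional) convergence of the Dirichlet series of `f` at `s`. -/
def ConvergesAt (f : ℕ+ → ℂ) (s : ℂ) : Prop :=
  ∃ l : ℂ, Tendsto (partialSum f s) atTop (𝓝 l)

/-- The sum of the Dirichlet series of `f` at `s` (meaningful where it converges). -/
def seriesSum (f : ℕ+ → ℂ) (s : ℂ) : ℂ := limUnder atTop (partialSum f s)

/-- The abscissa `σ_c` of (conditional) convergence: the infimum of the real `σ` such that the
series converges whenever `Re s > σ`. -/
def abscissa (f : ℕ+ → ℂ) : EReal :=
  sInf (Real.toEReal '' {σ : ℝ | ∀ s : ℂ, σ < s.re → ConvergesAt f s})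

/-! ### The field of meromorphic functions on a half-plane -/

/-- The half-plane `Re s > a`. -/
def halfPlane (a : ℝ) : Set ℂ := {s | a < s.re}

lemma isOpen_halfPlane (a : ℝ) : IsOpen (halfPlane a) :=
  isOpen_lt continuous_const Complex.continuous_re

lemma isConnected_halfPlane (a : ℝ) : IsConnected (halfPlane a) :=
  ⟨⟨((a + 1 : ℝ) : ℂ), by simp [halfPlane]⟩, (convex_halfSpace_re_gt a).isPreconnected⟩

lemma codiscreteWithin_halfPlane_neBot (a : ℝ) : (codiscreteWithin (halfPlane a)).NeBot := by
  rw [neBot_iff, ne_eq, ← empty_mem_iff_bot, mem_codiscreteWithin_iff_forall_mem_nhdsNE]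
  intro h
  obtain ⟨x, hx⟩ := (isConnected_halfPlane a).nonempty
  have h1 := h x hx
  rw [Set.empty_union] at h1
  have h2 : halfPlane a ∈ 𝓝[≠] x := mem_nhdsWithin_of_mem_nhds ((isOpen_halfPlane a).mem_nhds hx)
  have h3 := inter_mem h1 h2
  rw [Set.compl_inter_self] at h3
  exact (NeBot.ne inferInstance) (empty_mem_iff_bot.1 h3)

/-- Meromorphic functions on `Re s > a`, two of them being identified when they agree off a closed
discrete subset of the half-plane. -/
def meroSubring (a : ℝ) : Subring (Germ (codiscreteWithin (halfPlane a)) ℂ) where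
  carrier := {g | ∃ f : ℂ → ℂ, MeromorphicOn f (halfPlane a) ∧ g = (f : Germ _ ℂ)}
  mul_mem' := by
    rintro _ _ ⟨f, hf, rfl⟩ ⟨g, hg, rfl⟩
    exact ⟨f * g, hf.mul hg, rfl⟩
  one_mem' := ⟨fun _ => 1, MeromorphicOn.const 1, rfl⟩
  add_mem' := by
    rintro _ _ ⟨f, hf, rfl⟩ ⟨g, hg, rfl⟩
    exact ⟨f + g, hf.add hg, rfl⟩
  zero_mem' := ⟨fun _ => 0, MeromorphicOn.const 0, rfl⟩
  neg_mem' := by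
    rintro _ ⟨f, hf, rfl⟩
    exact ⟨-f, hf.neg, rfl⟩

/-- The field of meromorphic functions on the half-plane `Re s > a`. -/
def Mero (a : ℝ) : Type := meroSubring a

instance (a : ℝ) : CommRing (Mero a) := inferInstanceAs (CommRing (meroSubring a))

/-- The element of `Mero a` given by a function that is meromorphic on the half-plane. -/
def Mero.mk {a : ℝ} (f : ℂ → ℂ) (hf : MeromorphicOn f (halfPlane a)) : Mero a :=
  ⟨(f : Germ _ ℂ), f, hf, rfl⟩

lemma Mero.mk_eq_mk_iff {a : ℝ} {f g : ℂ → ℂ} (hf : MeromorphicOn f (halfPlane a))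
    (hg : MeromorphicOn g (halfPlane a)) :
    Mero.mk f hf = Mero.mk g hg ↔ f =ᶠ[codiscreteWithin (halfPlane a)] g :=
  Subtype.ext_iff.trans Germ.coe_eq

lemma Mero.isField (a : ℝ) : IsField (Mero a) where
  exists_pair_ne := by
    have := codiscreteWithin_halfPlane_neBot a
    refine ⟨0, 1, fun h => ?_⟩
    have h2 := congrArg Subtype.val h
    exact zero_ne_one (α := Germ (codiscreteWithin (halfPlane a)) ℂ) h2
  mul_comm := mul_comm
  mul_inv_cancel := by
    rintro ⟨_, f, hf, rfl⟩ hne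
    have hU := isOpen_halfPlane a
    have hconn := isConnected_halfPlane a
    have hex : ∃ u : halfPlane a, meromorphicOrderAt f u ≠ ⊤ := by
      by_contra! hc
      apply hne
      apply Subtype.ext
      refine Germ.coe_eq.2 ?_
      rw [EventuallyEq, Filter.Eventually, mem_codiscreteWithin_iff_forall_mem_nhdsNE]
      intro x hx
      have h1 := meromorphicOrderAt_eq_top_iff.1 (hc ⟨x, hx⟩)
      filter_upwards [h1] with y hy
      exact Or.inl hy
    have hall := (hf.exists_meromorphicOrderAt_ne_top_iff_forall hconn).1 hex
    refine ⟨Mero.mk f⁻¹ hf.inv, ?_⟩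
    apply Subtype.ext
    refine Germ.coe_eq.2 ?_
    rw [EventuallyEq, Filter.Eventually, mem_codiscreteWithin_iff_forall_mem_nhdsNE]
    intro x hx
    have h1 := (meromorphicOrderAt_ne_top_iff_eventually_ne_zero (hf x hx)).1 (hall ⟨x, hx⟩)
    filter_upwards [h1] with y hy
    exact Or.inl (mul_inv_cancel₀ hy)

instance (a : ℝ) : Field (Mero a) := (Mero.isField a).toField

instance (a : ℝ) : Algebra ℂ (Mero a) :=
  RingHom.toAlgebra
    { toFun := fun c => Mero.mk (fun _ => c) (MeromorphicOn.const c)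
      map_one' := rfl
      map_mul' := fun _ _ => rfl
      map_zero' := rfl
      map_add' := fun _ _ => rfl }

end Dirichlet

end DivisorSL2

end

noncomputable section

namespace DivisorSL2

/-! ### The formal action of ρ: T acts as multiplication by ζ -/

section Algebra

open PowerSeries Matrix MatrixGroups
open scoped ArithmeticFunction.zeta ArithmeticFunction.Moebius

/-! ### Rows of column-finite matrices -/

/-! The conjugations defining ρ make sense on the whole ring M₂(ℂ⟦t⟧): `rhoMat` is a ring
homomorphism whose values at `sMat` and `jMat` are ρ(S) and ρ(T). The matrices P and Z are built so
that ρ(T) = D (`rhoMat_jMat`). So T acts on formal Dirichlet series as multiplication by ζ, and T⁻¹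
as multiplication by ζ⁻¹ = μ. Write J for `jMat`. It has determinant 1 and trace 2 + t, so t = J - 2
+ J⁻¹, and multiplying M by t multiplies 1.rhoMat(M) by τ = ζ - 2 + ζ⁻¹ (`rowSeries_X_smul`). By
t-adic approximation, multiplying M by g multiplies it by a fixed series γ (`gArith`).

The series 1.rhoMat(M) depends only on the first row of M (`entry_rhoMat_one_congr`). The rows (1,
0), (0, 1), (g, 0) give 1, φ, γ, and comparing the first rows of -SJ and J gives ζφ = γ + φ + τφ and
ζ = 1 + φ + γφ. Hence γ = (1 - ζ⁻¹)φ, and with z = ζ - 1 the series φ satisfies φ = z + z² - zφ -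
zφ² (`phiArith_quadratic`).

Let V be the additive group generated by all ζ^m and ζ^m φ. It is clearly stable under T and T⁻¹.
Since J + J⁻¹ is scalar, it commutes with S. This yields a second-order recursion in m for the
action of S on ζ^m F, so stability under S follows from the four cases 1, ζ, φ, ζφ
(`actHom_sMat_mem`). Hence V contains the orbit of 1.

For convergence, the quadratic equation bounds the coefficients of φ, so that φ converges absolutely
for Re s ≥ 3. Elements of V are linear in φ, and ζ and μ converge absolutely for Re s > 1. By
Mertens' theorem (`tendsto_sum_Ioc_mul`) every element of V therefore converges, to the expected
sum, wherever Re s > 1 and φ converges, even conditionally. Partial summation gives analyticity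
(`analyticOnNhd_of_sumsTo`). -/

lemma end_ext_entry {ι : Type} {A B : Module.End ℂ (Col ι)}
    (h : ∀ i j, entry A i j = entry B i j) : A = B := by
  ext1 j
  ext1
  exact Finsupp.ext fun i => h i j

lemma entry_mul_congr {ι : Type} {A B : Module.End ℂ (Col ι)} {i : ι}
    (h : ∀ k, entry A i k = entry B i k) (C : Module.End ℂ (Col ι)) (j : ι) :
    entry (A * C) i j = entry (B * C) i j := by
  simp only [entry_mul, h]

/-- The shift matrix, with ones just above the diagonal. -/
def shift : Module.End ℂ (Col ℕ) :=
  ofCols fun j => if j = 0 then 0 else Finsupp.single (j - 1) 1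

lemma entry_shift (i j : ℕ) : entry shift i j = if j = i + 1 then 1 else 0 := by
  rw [entry, shift, ofCols_single, one_smul]
  rcases j with _ | j
  · simp
  · simp [Finsupp.single_apply]

lemma entry_shift_mul (A : Module.End ℂ (Col ℕ)) (i j : ℕ) :
    entry (shift * A) i j = entry A (i + 1) j := by
  rw [entry_mul]
  simp only [entry_shift, mul_ite, mul_one, mul_zero]
  rw [Finsupp.sum_ite_eq']
  simp only [Finsupp.mem_support_iff, entry]
  split_ifs with h
  · rfl
  · exact (not_not.1 h).symm

lemma entry_P_mul (n j : ℕ) (A : Module.End ℂ (Col ℕ)) :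
    entry (P * A) n j = entry ((Jt - 1) ^ n * A) 0 j := by
  simp only [entry_mul, entry_P]

/-- Each row of P is the previous one times J̃ - 1, so P conjugates J̃ to a single infinite Jordan
block. -/
lemma P_mul_Jt_sub_one : P * (Jt - 1) = shift * P := by
  apply end_ext_entry
  intro n j
  rw [entry_P_mul, entry_shift_mul, entry_P, pow_succ]

lemma val2_two_mul (i : ℕ+) : val2 (2 * i) = val2 i + 1 := by
  conv_lhs => rw [← pow_mul_oddPart i, ← mul_assoc, ← pow_succ']
  exact val2_pow_mul _ _

lemma oddPart_two_mul (i : ℕ+) : oddPart (2 * i) = oddPart i := by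
  conv_lhs => rw [← pow_mul_oddPart i, ← mul_assoc, ← pow_succ']
  exact oddPart_pow_mul _ _

lemma psi_single (A : Module.End ℂ (Col ℕ)) (n : ℕ+) :
    psi A (Finsupp.single n 1) = strand n (A (Finsupp.single (val2 n) 1)) := by
  change psiFun A _ = _
  rw [psiFun, ofCols_single, one_smul]

lemma entry_psi_shift (i j : ℕ+) : entry (psi shift) i j = if j = 2 * i then 1 else 0 := by
  rw [entry, psi_single, shift, ofCols_single, one_smul]
  by_cases h : val2 j = 0
  · rw [if_pos h, map_zero, Finsupp.zero_apply, if_neg]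
    rintro rfl
    rw [val2_two_mul] at h
    omega
  · rw [if_neg h, strand, Finsupp.lmapDomain_apply, Finsupp.mapDomain_single,
      Finsupp.single_apply]
    refine if_congr ⟨fun hi => ?_, ?_⟩ rfl rfl
    · rw [← hi, ← mul_assoc, ← pow_succ', Nat.sub_add_cancel (Nat.pos_of_ne_zero h),
        pow_mul_oddPart]
    · rintro rfl
      rw [val2_two_mul, oddPart_two_mul, Nat.add_sub_cancel, pow_mul_oddPart]

lemma entry_Z_mul (i j : ℕ+) (A : Module.End ℂ (Col ℕ+)) :
    entry (Z * A) i j = entry ((D - 1) ^ val2 i * A) (oddPart i) j := by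
  simp only [entry_mul, entry_Z]

/-- Passing from i to 2i keeps the odd part and raises the exponent of 2 by one, so row 2i of Z is
row i times D - 1. Thus Z conjugates D to one Jordan block for each odd number. -/
lemma psi_shift_mul_Z : psi shift * Z = Z * (D - 1) := by
  apply end_ext_entry
  intro i j
  rw [entry_Z_mul, ← pow_succ, entry_mul]
  simp only [entry_psi_shift, mul_ite, mul_one, mul_zero]
  rw [Finsupp.sum_ite_eq']
  rw [← oddPart_two_mul, ← val2_two_mul, ← entry_Z]
  simp only [Finsupp.mem_support_iff, entry]
  split_ifs with h
  · rfl
  · exact (not_not.1 h).symm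

/-! ### The extension of `ρ` to matrices of power series -/

/-- Conjugation by a unit, as a ring homomorphism. -/
def conjHom {R : Type*} [Semiring R] (u : Rˣ) : R →+* R where
  toFun x := u * x * ↑u⁻¹
  map_one' := by simp
  map_zero' := by simp
  map_add' x y := by rw [mul_add, add_mul]
  map_mul' x y := by simp [mul_assoc]

lemma conjHom_apply {R : Type*} [Semiring R] (u : Rˣ) (x : R) : conjHom u x = u * x * ↑u⁻¹ := rfl

lemma conjHom_eq_iff {R : Type*} [Semiring R] (u : Rˣ) (x y : R) :
    conjHom u x = y ↔ (u : R) * x = y * u := by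
  rw [conjHom_apply, Units.mul_inv_eq_iff_eq_mul]

/-- The ring homomorphism `X ↦ Z⁻¹ ψ(P X P⁻¹) Z` on matrices of power series. -/
def rhoMat : Matrix (Fin 2) (Fin 2) ℂ⟦X⟧ →+* Module.End ℂ (Col ℕ+) :=
  (conjHom isUnit_Z.unit⁻¹).comp (psi.comp ((conjHom isUnit_P.unit).comp toeplitz))

/-- The matrix of power series whose Toeplitz matrix is `τ₁(S)`. -/
def sMat : Matrix (Fin 2) (Fin 2) ℂ⟦X⟧ := !![0, -1; 1, 0]

/-- The matrix of power series whose Toeplitz matrix is `τ₁(T)`. -/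
def jMat : Matrix (Fin 2) (Fin 2) ℂ⟦X⟧ := !![1, 1 + gSeries; gSeries, 1 + X]

/-- The inverse of `jMat`. -/
def jMatInv : Matrix (Fin 2) (Fin 2) ℂ⟦X⟧ := !![1 + X, -(1 + gSeries); -gSeries, 1]

lemma jMat_mul_jMatInv : jMat * jMatInv = 1 := by
  have hg := gSeries_sq_add
  rw [jMat, jMatInv, ← hg]
  ext1 i j
  fin_cases i <;> fin_cases j <;> simp <;> ring

lemma coe_rho (Y : SL(2, ℤ)) : (rho Y : Module.End ℂ (Col ℕ+)) =
    conjHom isUnit_Z.unit⁻¹ (psi (conjHom isUnit_P.unit (tau1 Y : Module.End ℂ (Col ℕ)))) := rfl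

lemma rho_S : (rho ModularGroup.S : Module.End ℂ (Col ℕ+)) = rhoMat sMat := by
  rw [coe_rho, tau1_S, St, blockMatrix_sBlock]; rfl

lemma rho_T : (rho ModularGroup.T : Module.End ℂ (Col ℕ+)) = rhoMat jMat := by
  rw [coe_rho, tau1_T, Jt, blockMatrix_jBlock]; rfl

/-- J̃ and D have matching Jordan forms: P carries J̃ to 1 + `shift`, and Z carries D to `psi` of
that matrix. -/
lemma rhoMat_jMat : rhoMat jMat = D := by
  have h1 : conjHom isUnit_P.unit (toeplitz jMat) = 1 + shift := by
    have h : toeplitz jMat = Jt := by rw [Jt, blockMatrix_jBlock]; rfl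
    have h2 := P_mul_Jt_sub_one
    rw [h, conjHom_eq_iff, IsUnit.unit_spec]
    have h3 : P * Jt = P * (Jt - 1) + P * 1 := by
      rw [← mul_add]
      exact congrArg (P * ·) (sub_add_cancel Jt 1).symm
    rw [h3, h2, add_mul, one_mul, mul_one, add_comm]
  change conjHom isUnit_Z.unit⁻¹ (psi (conjHom isUnit_P.unit (toeplitz jMat))) = D
  have h2 : (1 + psi shift) * Z = Z * D := by
    rw [add_mul, psi_shift_mul_Z, one_mul]
    conv_lhs => enter [1]; rw [← mul_one Z]
    rw [← mul_add]
    exact congrArg (Z * ·) (add_sub_cancel 1 D)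
  rw [h1, map_add, map_one, conjHom_apply, inv_inv, IsUnit.unit_spec, mul_assoc, h2,
    ← mul_assoc, IsUnit.val_inv_mul, one_mul]

lemma val2_one : val2 1 = 0 := by simp [val2]

lemma oddPart_one : oddPart 1 = 1 := PNat.eq (by simp [oddPart])

/-- The index 1 lies only on the strand of odd part 1, at position 0; on any other strand both sides
vanish. -/
lemma strand_apply_one_congr (n : ℕ+) {v w : Col ℕ} (h : v 0 = w 0) :
    strand n v 1 = strand n w 1 := by
  have hinj : Function.Injective fun k : ℕ => 2 ^ k * oddPart n := by
    intro k l hkl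
    simpa [val2_pow_mul] using congrArg val2 hkl
  simp only [strand, Finsupp.lmapDomain_apply]
  by_cases hn : oddPart n = 1
  · have e : (1 : ℕ+) = (fun k : ℕ => 2 ^ k * oddPart n) 0 := by simp [hn]
    rw [e, Finsupp.mapDomain_apply hinj, Finsupp.mapDomain_apply hinj, h]
  · have hr : (1 : ℕ+) ∉ Set.range fun k : ℕ => 2 ^ k * oddPart n := by
      rintro ⟨k, hk⟩
      have h1 := oddPart_pow_mul k n
      simp only at hk
      rw [hk] at h1
      apply hn
      rw [← h1, oddPart_one]
    rw [Finsupp.mapDomain_of_notMem_range _ _ hr, Finsupp.mapDomain_of_notMem_range _ _ hr]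

lemma entry_Z_inv_one (j : ℕ+) :
    entry (↑isUnit_Z.unit⁻¹ : Module.End ℂ (Col ℕ+)) 1 j = entry 1 1 j := by
  have h : ∀ k, entry Z 1 k = entry 1 1 k := fun k => by
    rw [entry_Z, val2_one, oddPart_one, pow_zero]
  have h2 := entry_mul_congr h (↑isUnit_Z.unit⁻¹ : Module.End ℂ (Col ℕ+)) j
  rw [one_mul, IsUnit.mul_val_inv] at h2
  exact h2.symm

/-- The first rows of P and Z⁻¹ are those of the identity, so left multiplication by them does not
change the first row. Right multiplication never mixes rows. -/
lemma entry_rhoMat_one_congr {X Y : Matrix (Fin 2) (Fin 2) ℂ⟦X⟧} (h : ∀ j, X 0 j = Y 0 j)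
    (n : ℕ+) : entry (rhoMat X) 1 n = entry (rhoMat Y) 1 n := by
  have hT : ∀ k, entry (toeplitz X) 0 k = entry (toeplitz Y) 0 k := by
    intro k
    obtain ⟨c, b, rfl⟩ := exists_fin_two k
    have h1 := entry_toeplitz X 0 c 0 b
    have h2 := entry_toeplitz Y 0 c 0 b
    rw [h b] at h1
    exact h1.trans h2.symm
  have hP : ∀ k, entry (conjHom isUnit_P.unit (toeplitz X)) 0 k =
      entry (conjHom isUnit_P.unit (toeplitz Y)) 0 k := by
    intro k
    refine entry_mul_congr (fun l => ?_) _ k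
    rw [IsUnit.unit_spec, entry_P_mul, entry_P_mul, pow_zero, one_mul, one_mul]
    exact hT l
  have hpsi : ∀ k, entry (psi (conjHom isUnit_P.unit (toeplitz X))) 1 k =
      entry (psi (conjHom isUnit_P.unit (toeplitz Y))) 1 k := by
    intro k
    rw [entry, psi_single, entry, psi_single]
    exact strand_apply_one_congr k (hP _)
  refine entry_mul_congr (fun l => ?_) _ n
  rw [entry_mul_congr entry_Z_inv_one, entry_mul_congr entry_Z_inv_one, one_mul, one_mul]
  exact hpsi l

/-! ### The right action on formal Dirichlet series -/

lemma act_eq_linearCombination (f : ℕ+ → ℂ) (A : Module.End ℂ (Col ℕ+)) (n : ℕ+) :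
    act f A n = Finsupp.linearCombination ℂ f (A (Finsupp.single n 1)) := by
  simp [act, Finsupp.linearCombination_apply]

lemma linearCombination_act (f : ℕ+ → ℂ) (A : Module.End ℂ (Col ℕ+)) :
    Finsupp.linearCombination ℂ (act f A) = Finsupp.linearCombination ℂ f ∘ₗ A := by
  ext1 n
  ext1
  simp [act_eq_linearCombination]

lemma act_mul (f : ℕ+ → ℂ) (A B : Module.End ℂ (Col ℕ+)) :
    act f (A * B) = act (act f A) B := by
  funext n
  rw [act_eq_linearCombination, act_eq_linearCombination, linearCombination_act]
  rfl

lemma act_one (f : ℕ+ → ℂ) : act f 1 = f := by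
  funext n
  simp [act_eq_linearCombination]

lemma act_oneSeries (A : Module.End ℂ (Col ℕ+)) (n : ℕ+) : act oneSeries A n = entry A 1 n := by
  rw [act, entry]
  simp only [oneSeries, mul_ite, mul_one, mul_zero]
  rw [Finsupp.sum_ite_eq']
  simp only [Finsupp.mem_support_iff]
  split_ifs with h
  · rfl
  · exact (not_not.1 h).symm

/-- The arithmetic function with the same values as a sequence on the positive integers. -/
def toArith (f : ℕ+ → ℂ) : ArithmeticFunction ℂ :=
  ⟨fun n => if h : 0 < n then f ⟨n, h⟩ else 0, by simp⟩

/-- The restriction of an arithmetic function to the positive integers. -/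
def ofArith (F : ArithmeticFunction ℂ) : ℕ+ → ℂ := fun n => F n

@[simp] lemma toArith_apply (f : ℕ+ → ℂ) (n : ℕ+) : toArith f n = f n :=
  dif_pos n.pos

lemma toArith_succ (f : ℕ+ → ℂ) (n : ℕ) : toArith f (n + 1) = f n.succPNat :=
  toArith_apply f n.succPNat

lemma arith_ext {F G : ArithmeticFunction ℂ} (h : ∀ n : ℕ+, F n = G n) : F = G := by
  ext n
  rcases Nat.eq_zero_or_pos n with rfl | hn
  · simp
  · exact h ⟨n, hn⟩

@[simp] lemma ofArith_toArith (f : ℕ+ → ℂ) : ofArith (toArith f) = f :=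
  funext fun n => toArith_apply f n

@[simp] lemma toArith_ofArith (F : ArithmeticFunction ℂ) : toArith (ofArith F) = F :=
  arith_ext fun n => toArith_apply _ n

/-- The right action of a column-finite matrix on formal Dirichlet series, viewed as arithmetic
functions. -/
def actHom (A : Module.End ℂ (Col ℕ+)) : ArithmeticFunction ℂ →+ ArithmeticFunction ℂ where
  toFun F := toArith (act (ofArith F) A)
  map_zero' := by
    apply arith_ext; intro n
    simp [act, ofArith]
  map_add' F G := by
    apply arith_ext; intro n
    simp [act, ofArith, mul_add, Finsupp.sum_add]

lemma actHom_toArith (f : ℕ+ → ℂ) (A : Module.End ℂ (Col ℕ+)) :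
    actHom A (toArith f) = toArith (act f A) := by
  change toArith (act (ofArith (toArith f)) A) = _
  rw [ofArith_toArith]

lemma actHom_apply_coe (F : ArithmeticFunction ℂ) (A : Module.End ℂ (Col ℕ+)) (n : ℕ+) :
    actHom A F n = act (ofArith F) A n := toArith_apply _ n

lemma actHom_mul (A B : Module.End ℂ (Col ℕ+)) (F : ArithmeticFunction ℂ) :
    actHom (A * B) F = actHom B (actHom A F) := by
  change toArith (act (ofArith F) (A * B)) = _
  rw [act_mul, ← actHom_toArith]
  rfl

lemma actHom_one (F : ArithmeticFunction ℂ) : actHom 1 F = F := by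
  change toArith (act (ofArith F) 1) = _
  rw [act_one, toArith_ofArith]

lemma actHom_add (A B : Module.End ℂ (Col ℕ+)) (F : ArithmeticFunction ℂ) :
    actHom (A + B) F = actHom A F + actHom B F := by
  apply arith_ext; intro n
  simp [actHom_apply_coe, act_eq_linearCombination]

lemma toArith_oneSeries : toArith oneSeries = 1 := by
  apply arith_ext; intro n
  rw [toArith_apply, oneSeries, ArithmeticFunction.one_apply]
  simp

lemma actHom_D (F : ArithmeticFunction ℂ) : actHom D F = (ζ : ArithmeticFunction ℂ) * F := by
  apply arith_ext; intro n
  rw [actHom_apply_coe, act_eq_linearCombination, D, ofCols_single, one_smul, map_sum,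
    ArithmeticFunction.coe_zeta_mul_apply]
  simp only [Finsupp.linearCombination_single, one_smul, ofArith]
  refine Finset.sum_nbij (fun i : ℕ+ => (i : ℕ)) ?_ ?_ ?_ ?_
  · intro i hi
    simp at hi ⊢
    exact hi.2
  · intro i _ j _ h
    exact PNat.eq h
  · intro i hi
    simp at hi
    have hpos : 0 < i := Nat.pos_of_dvd_of_pos hi n.pos
    refine ⟨⟨i, hpos⟩, ?_, rfl⟩
    simp
    exact ⟨Nat.le_of_dvd n.pos hi, hi⟩
  · intro i _
    rfl

end Algebra

/-! ### Formal Dirichlet series in the orbit of 1 -/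

section Orbit

open PowerSeries Matrix MatrixGroups
open scoped ArithmeticFunction.zeta ArithmeticFunction.Moebius

/-! ### The formal Dirichlet series attached to a row of power series -/

lemma actHom_rhoMat_jMat (F : ArithmeticFunction ℂ) :
    actHom (rhoMat jMat) F = (ζ : ArithmeticFunction ℂ) * F := by
  rw [rhoMat_jMat, actHom_D]

lemma jMatInv_mul_jMat : jMatInv * jMat = 1 := mul_eq_one_comm.1 jMat_mul_jMatInv

lemma actHom_rhoMat_jMatInv (F : ArithmeticFunction ℂ) :
    actHom (rhoMat jMatInv) F = (μ : ArithmeticFunction ℂ) * F := by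
  have h : (ζ : ArithmeticFunction ℂ) * actHom (rhoMat jMatInv) F = F := by
    rw [← actHom_rhoMat_jMat, ← actHom_mul, ← map_mul, jMatInv_mul_jMat, map_one, actHom_one]
  rw [← h, ← mul_assoc, ArithmeticFunction.coe_moebius_mul_coe_zeta, one_mul, h]

/-- The first row of `X`, transformed into a formal Dirichlet series. -/
def rowSeries : Matrix (Fin 2) (Fin 2) ℂ⟦X⟧ →+ ArithmeticFunction ℂ where
  toFun M := actHom (rhoMat M) 1
  map_zero' := by
    rw [map_zero]
    have := actHom_add 0 0 1
    rw [add_zero] at this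
    exact left_eq_add.1 this
  map_add' M N := by rw [map_add, actHom_add]

lemma rowSeries_apply (M : Matrix (Fin 2) (Fin 2) ℂ⟦X⟧) : rowSeries M = actHom (rhoMat M) 1 := rfl

lemma rowSeries_mul (M N : Matrix (Fin 2) (Fin 2) ℂ⟦X⟧) :
    rowSeries (M * N) = actHom (rhoMat N) (rowSeries M) := by
  rw [rowSeries_apply, rowSeries_apply, map_mul, actHom_mul]

lemma rowSeries_one : rowSeries 1 = 1 := by
  rw [rowSeries_apply, map_one rhoMat, actHom_one]

lemma rowSeries_congr {M N : Matrix (Fin 2) (Fin 2) ℂ⟦X⟧} (h : ∀ j, M 0 j = N 0 j) :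
    rowSeries M = rowSeries N := by
  rw [rowSeries_apply, rowSeries_apply, ← toArith_oneSeries, actHom_toArith, actHom_toArith]
  refine congrArg toArith (funext fun n => ?_)
  rw [act_oneSeries, act_oneSeries, entry_rhoMat_one_congr h]

lemma rowSeries_mul_jMat (M : Matrix (Fin 2) (Fin 2) ℂ⟦X⟧) :
    rowSeries (M * jMat) = (ζ : ArithmeticFunction ℂ) * rowSeries M := by
  rw [rowSeries_mul, actHom_rhoMat_jMat]

/-- The formal Dirichlet series `(ζ - 1) ^ 2 / ζ`. -/
def tauSeries : ArithmeticFunction ℂ := ((ζ : ArithmeticFunction ℂ) - 1) ^ 2 * μ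

/-- After multiplication by ζ, the scalar t becomes tJ = (J - 1)², which acts as (ζ - 1)²; dividing
by ζ again gives τ. -/
lemma rowSeries_X_smul (M : Matrix (Fin 2) (Fin 2) ℂ⟦X⟧) :
    rowSeries ((X : ℂ⟦X⟧) • M) = tauSeries * rowSeries M := by
  -- Cayley–Hamilton for determinant 1 and trace 2 + t.
  have hj : (X : ℂ⟦X⟧) • jMat = jMat * jMat - jMat - jMat + 1 := by
    rw [jMat, ← gSeries_sq_add]
    ext1 i j
    fin_cases i <;> fin_cases j <;> simp <;> ring
  have h : (ζ : ArithmeticFunction ℂ) * rowSeries ((X : ℂ⟦X⟧) • M) =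
      ((ζ : ArithmeticFunction ℂ) - 1) ^ 2 * rowSeries M := by
    rw [← rowSeries_mul_jMat, smul_mul_assoc, ← mul_smul_comm, hj]
    simp only [mul_add, mul_sub, map_add, map_sub, mul_one, ← mul_assoc, rowSeries_mul_jMat]
    ring
  rw [tauSeries, mul_right_comm, ← h, mul_right_comm,
    ArithmeticFunction.coe_zeta_mul_coe_moebius, one_mul]

/-- A series without constant term starts at n = 2 or later, so its K-th power starts at 2^K or
later. Thus high powers of τ are negligible coefficientwise. -/
lemma pow_mul_apply_eq_zero {F : ArithmeticFunction ℂ} (hF : F 1 = 0) (E : ArithmeticFunction ℂ)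
    (K : ℕ) : ∀ n < 2 ^ K, (F ^ K * E) n = 0 := by
  induction K with
  | zero =>
    intro n hn
    obtain rfl : n = 0 := by simpa using hn
    simp
  | succ K ih =>
    intro n hn
    rw [pow_succ', mul_assoc, ArithmeticFunction.mul_apply]
    refine Finset.sum_eq_zero ?_
    rintro ⟨d, e⟩ h
    rw [Nat.mem_divisorsAntidiagonal] at h
    simp only at h ⊢
    rcases Nat.lt_or_ge d 2 with hd | hd
    · have hd1 : d = 1 := by
        have : d ≠ 0 := by rintro rfl; simp at h; omega
        omega
      rw [hd1, hF, zero_mul]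
    · rw [ih e, mul_zero]
      rw [pow_succ'] at hn
      nlinarith

lemma tauSeries_one : tauSeries 1 = 0 := by
  have h : ((ζ : ArithmeticFunction ℂ) - 1) 1 = 0 := by
    change (ζ : ArithmeticFunction ℂ) 1 - (1 : ArithmeticFunction ℂ) 1 = 0
    simp
  simp [tauSeries, pow_two, h]

/-- The power series with given integer coefficients. -/
def intSeries (x : ℤ⟦X⟧) : ℂ⟦X⟧ := PowerSeries.map (Int.castRingHom ℂ) x

/-- Writing x = t x' + c, the contributions of c cancel, and the difference for x is τ times that
for x'. Coefficients are integers because `rowSeries` is only recorded as an additive map; this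
suffices for g. -/
lemma exists_rowSeries_smul_sub (K : ℕ) (x : ℤ⟦X⟧) (M : Matrix (Fin 2) (Fin 2) ℂ⟦X⟧) :
    ∃ E, rowSeries (intSeries x • M) - rowSeries (intSeries x • 1) * rowSeries M =
      tauSeries ^ K * E := by
  induction K generalizing x with
  | zero => exact ⟨_, by rw [pow_zero, one_mul]⟩
  | succ K ih =>
    obtain ⟨E, hE⟩ := ih (PowerSeries.mk fun p => coeff (p + 1) x)
    refine ⟨E, ?_⟩
    have hx : ∀ N : Matrix (Fin 2) (Fin 2) ℂ⟦X⟧, intSeries x • N =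
        (X : ℂ⟦X⟧) • (intSeries (PowerSeries.mk fun p => coeff (p + 1) x) • N) +
          (constantCoeff x) • N := by
      intro N
      conv_lhs => rw [PowerSeries.eq_X_mul_shift_add_const x]
      rw [intSeries, map_add, map_mul, PowerSeries.map_X, add_smul, mul_smul, PowerSeries.map_C]
      rw [eq_intCast, map_intCast, Int.cast_smul_eq_zsmul]
      rfl
    rw [hx, hx, map_add, map_add, map_zsmul, map_zsmul, rowSeries_X_smul, rowSeries_X_smul,
      rowSeries_one, pow_succ', mul_assoc, ← hE]
    simp only [zsmul_eq_mul]
    ring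

/-- The difference is divisible by every power of τ. For the n-th coefficient the exponent n is
enough, as n < 2^n. -/
lemma rowSeries_intSeries_smul (x : ℤ⟦X⟧) (M : Matrix (Fin 2) (Fin 2) ℂ⟦X⟧) :
    rowSeries (intSeries x • M) = rowSeries (intSeries x • 1) * rowSeries M := by
  rw [← sub_eq_zero]
  ext n
  obtain ⟨E, hE⟩ := exists_rowSeries_smul_sub n x M
  rw [hE, pow_mul_apply_eq_zero tauSeries_one E n n Nat.lt_two_pow_self]
  rfl

lemma rowSeries_gSeries_smul (M : Matrix (Fin 2) (Fin 2) ℂ⟦X⟧) :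
    rowSeries (gSeries • M) = rowSeries (gSeries • 1) * rowSeries M := by
  have h : gSeries = intSeries (PowerSeries.mk fun n => if n = 0 then 0 else bSeq n) := by
    ext n
    by_cases hn : n = 0 <;> simp [gSeries, intSeries, hn]
  rw [h, rowSeries_intSeries_smul]

/-! ### The series `φ` -/

/-- The Dirichlet series `φ` as an arithmetic function. -/
def phiArith : ArithmeticFunction ℂ := toArith phiSeries

lemma actHom_rho_one (Y : SL(2, ℤ)) : actHom (rho Y) 1 = toArith (act oneSeries (rho Y)) := by
  rw [← toArith_oneSeries, actHom_toArith]

lemma phiArith_eq : phiArith = rowSeries (-sMat) := by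
  -- Only the values of ρ on the generators are at hand, so -S is written as S³.
  have hS : -ModularGroup.S = ModularGroup.S * ModularGroup.S * ModularGroup.S := by decide
  have hs : sMat * sMat * sMat = -sMat := by
    rw [sMat]
    ext1 i j
    fin_cases i <;> fin_cases j <;> simp
  rw [phiArith, phiSeries, ← actHom_rho_one, hS, map_mul, map_mul, Units.val_mul, Units.val_mul,
    rho_S, ← map_mul, ← map_mul, hs]
  rfl

/-- The formal Dirichlet series obtained from the scalar matrix `g`. -/
def gArith : ArithmeticFunction ℂ := rowSeries (gSeries • 1)

/-- The row (0, 1) times J is (g, 1 + t). -/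
lemma zeta_mul_phiArith :
    (ζ : ArithmeticFunction ℂ) * phiArith = gArith + phiArith + tauSeries * phiArith := by
  rw [phiArith_eq, ← rowSeries_X_smul, gArith, ← rowSeries_mul_jMat, ← map_add, ← map_add]
  refine rowSeries_congr fun j => ?_
  fin_cases j <;> simp [sMat, jMat]

/-- The first row of J is (1, 1 + g). -/
lemma zeta_eq : (ζ : ArithmeticFunction ℂ) = 1 + phiArith + gArith * phiArith := by
  rw [phiArith_eq, gArith, ← rowSeries_gSeries_smul]
  conv_lhs => rw [← mul_one (ζ : ArithmeticFunction ℂ), ← rowSeries_one, ← rowSeries_mul_jMat]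
  rw [← rowSeries_one, ← map_add, ← map_add]
  refine rowSeries_congr fun j => ?_
  fin_cases j <;> simp [sMat, jMat]

lemma tauSeries_eq : tauSeries = (ζ : ArithmeticFunction ℂ) - 2 + μ := by
  have h := ArithmeticFunction.coe_zeta_mul_coe_moebius (R := ℂ)
  rw [tauSeries]
  linear_combination ((ζ : ArithmeticFunction ℂ) - 2) * h

/-- Obtained by eliminating `gArith` from the two preceding relations. On the right every φ carries
a factor ζ - 1, which has no constant term, so the equation determines the coefficients of φ
recursively; `cubeSum_phiArith_le` exploits this. -/
lemma phiArith_quadratic :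
    phiArith = ((ζ : ArithmeticFunction ℂ) - 1) +
      ((ζ : ArithmeticFunction ℂ) - 1) * ((ζ : ArithmeticFunction ℂ) - 1) -
      ((ζ : ArithmeticFunction ℂ) - 1) * phiArith -
      ((ζ : ArithmeticFunction ℂ) - 1) * (phiArith * phiArith) := by
  have h := ArithmeticFunction.coe_zeta_mul_coe_moebius (R := ℂ)
  have h1 := zeta_mul_phiArith
  have h2 := zeta_eq
  rw [tauSeries_eq] at h1
  linear_combination (-(ζ : ArithmeticFunction ℂ)) * h2 +
    ((ζ : ArithmeticFunction ℂ) * phiArith) * h1 + (phiArith * phiArith) * h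

/-! ### Stability of the span of `ζ ^ m` and `ζ ^ m φ` -/

/-- The formal Dirichlet series `ζ ^ m`. -/
def zetaPow (m : ℤ) : ArithmeticFunction ℂ :=
  ((ArithmeticFunction.zetaUnit ^ m : (ArithmeticFunction ℂ)ˣ) : ArithmeticFunction ℂ)

lemma zetaPow_zero : zetaPow 0 = 1 := by simp [zetaPow]

lemma zetaPow_one : zetaPow 1 = ζ := by simp [zetaPow]

lemma zetaPow_neg_one : zetaPow (-1) = μ := by simp [zetaPow]

lemma zetaPow_add (m n : ℤ) : zetaPow (m + n) = zetaPow m * zetaPow n := by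
  rw [zetaPow, _root_.zpow_add, Units.val_mul]; rfl

/-- The additive group spanned by `ζ ^ m` and `ζ ^ m φ`. -/
def zetaPhiSpan : AddSubgroup (ArithmeticFunction ℂ) :=
  AddSubgroup.closure ({F | ∃ m, F = zetaPow m} ∪ {F | ∃ m, F = zetaPow m * phiArith})

lemma zetaPow_mem (m : ℤ) : zetaPow m ∈ zetaPhiSpan :=
  AddSubgroup.subset_closure (Or.inl ⟨m, rfl⟩)

lemma zetaPow_mul_phiArith_mem (m : ℤ) : zetaPow m * phiArith ∈ zetaPhiSpan :=
  AddSubgroup.subset_closure (Or.inr ⟨m, rfl⟩)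

lemma one_mem_zetaPhiSpan : 1 ∈ zetaPhiSpan := zetaPow_zero ▸ zetaPow_mem 0

lemma phiArith_mem : phiArith ∈ zetaPhiSpan := by
  simpa [zetaPow_zero] using zetaPow_mul_phiArith_mem 0

lemma zetaPow_mul_mem (k : ℤ) {F : ArithmeticFunction ℂ} (hF : F ∈ zetaPhiSpan) :
    zetaPow k * F ∈ zetaPhiSpan := by
  induction hF using AddSubgroup.closure_induction with
  | mem F h =>
    rcases h with ⟨m, rfl⟩ | ⟨m, rfl⟩
    · rw [← zetaPow_add]; exact zetaPow_mem _
    · rw [← mul_assoc, ← zetaPow_add]; exact zetaPow_mul_phiArith_mem _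
  | zero => rw [mul_zero]; exact zero_mem _
  | add F G _ _ hF hG => rw [mul_add]; exact add_mem hF hG
  | neg F _ hF =>
    have h : zetaPow k * -F = -(zetaPow k * F) := by ring
    rw [h]
    exact neg_mem hF

/-- J + J⁻¹ is the scalar matrix 2 + t, hence commutes with S, and it acts as multiplication by ζ +
ζ⁻¹. -/
lemma actHom_sMat_trace (F : ArithmeticFunction ℂ) :
    actHom (rhoMat sMat) (zetaPow 1 * F) + actHom (rhoMat sMat) (zetaPow (-1) * F) =
      zetaPow 1 * actHom (rhoMat sMat) F + zetaPow (-1) * actHom (rhoMat sMat) F := by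
  have h : (jMat + jMatInv) * sMat = sMat * (jMat + jMatInv) := by
    rw [jMat, jMatInv, sMat]
    ext1 i j
    fin_cases i <;> fin_cases j <;> simp <;> ring
  rw [zetaPow_one, zetaPow_neg_one]
  simp only [← actHom_rhoMat_jMat, ← actHom_rhoMat_jMatInv, ← actHom_mul, ← actHom_add,
    ← map_mul, ← map_add]
  rw [← add_mul, ← mul_add, h]

lemma actHom_sMat_zetaPow_mul_mem {F : ArithmeticFunction ℂ}
    (h0 : actHom (rhoMat sMat) F ∈ zetaPhiSpan)
    (h1 : actHom (rhoMat sMat) (zetaPow 1 * F) ∈ zetaPhiSpan) (m : ℤ) :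
    actHom (rhoMat sMat) (zetaPow m * F) ∈ zetaPhiSpan := by
  have key : ∀ k : ℤ, actHom (rhoMat sMat) (zetaPow (k + 1) * F) +
      actHom (rhoMat sMat) (zetaPow (k - 1) * F) =
      zetaPow 1 * actHom (rhoMat sMat) (zetaPow k * F) +
        zetaPow (-1) * actHom (rhoMat sMat) (zetaPow k * F) := by
    intro k
    rw [← actHom_sMat_trace, ← mul_assoc, ← mul_assoc, ← zetaPow_add, ← zetaPow_add,
      add_comm 1 k, add_comm (-1) k]
    rfl
  -- The recursion `key` has order two, so the induction, in both directions, carries two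
  -- consecutive exponents.
  have both : actHom (rhoMat sMat) (zetaPow m * F) ∈ zetaPhiSpan ∧
      actHom (rhoMat sMat) (zetaPow (m + 1) * F) ∈ zetaPhiSpan := by
    induction m using Int.induction_on with
    | zero => exact ⟨by rwa [zetaPow_zero, one_mul], by rwa [zero_add]⟩
    | succ i ih =>
      refine ⟨ih.2, ?_⟩
      have h := eq_sub_of_add_eq (key (i + 1))
      rw [h, add_sub_cancel_right]
      exact sub_mem (add_mem (zetaPow_mul_mem _ ih.2) (zetaPow_mul_mem _ ih.2)) ih.1
    | pred i ih =>
      refine ⟨?_, by rw [sub_add_cancel]; exact ih.1⟩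
      have h := eq_sub_of_add_eq' (key (-i))
      rw [h]
      exact sub_mem (add_mem (zetaPow_mul_mem _ ih.1) (zetaPow_mul_mem _ ih.1)) ih.2
  exact both.1

lemma actHom_sMat_one : actHom (rhoMat sMat) 1 = -phiArith := by
  rw [phiArith_eq, map_neg, neg_neg]
  rfl

lemma actHom_sMat_phiArith : actHom (rhoMat sMat) phiArith = 1 := by
  rw [phiArith_eq, ← rowSeries_mul, ← rowSeries_one]
  congr 1
  rw [sMat]
  ext1 i j
  fin_cases i <;> fin_cases j <;> simp

lemma actHom_sMat_zeta : actHom (rhoMat sMat) ζ = 1 + gArith - phiArith := by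
  have h : (ζ : ArithmeticFunction ℂ) = rowSeries jMat := by
    rw [← one_mul jMat, rowSeries_mul_jMat, rowSeries_one, mul_one]
  rw [h, ← rowSeries_mul, phiArith_eq, gArith, ← rowSeries_one, ← map_add, ← map_sub]
  refine rowSeries_congr fun j => ?_
  fin_cases j <;> simp [sMat, jMat]

lemma actHom_sMat_zeta_mul_phiArith :
    actHom (rhoMat sMat) ((ζ : ArithmeticFunction ℂ) * phiArith) =
      1 + tauSeries - gArith * phiArith := by
  rw [phiArith_eq, ← rowSeries_mul_jMat, ← rowSeries_mul, gArith, ← rowSeries_gSeries_smul,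
    ← mul_one tauSeries, ← rowSeries_one, ← rowSeries_X_smul, ← map_add, ← map_sub]
  refine rowSeries_congr fun j => ?_
  fin_cases j <;> simp [sMat, jMat]

lemma actHom_sMat_mem {F : ArithmeticFunction ℂ} (hF : F ∈ zetaPhiSpan) :
    actHom (rhoMat sMat) F ∈ zetaPhiSpan := by
  have hζ : (ζ : ArithmeticFunction ℂ) ∈ zetaPhiSpan := zetaPow_one ▸ zetaPow_mem 1
  have hμ : (μ : ArithmeticFunction ℂ) ∈ zetaPhiSpan := zetaPow_neg_one ▸ zetaPow_mem (-1)
  have hζφ := zetaPow_mul_phiArith_mem 1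
  have hμφ := zetaPow_mul_phiArith_mem (-1)
  rw [zetaPow_one] at hζφ
  rw [zetaPow_neg_one] at hμφ
  have h1 := one_mem_zetaPhiSpan
  have hφ := phiArith_mem
  have hg : gArith ∈ zetaPhiSpan := by
    have h : gArith = phiArith - (μ : ArithmeticFunction ℂ) * phiArith := by
      have := zeta_mul_phiArith
      rw [tauSeries_eq] at this
      linear_combination -this
    rw [h]
    exact sub_mem hφ hμφ
  induction hF using AddSubgroup.closure_induction with
  | mem F h =>
    rcases h with ⟨m, rfl⟩ | ⟨m, rfl⟩
    · rw [← mul_one (zetaPow m)]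
      refine actHom_sMat_zetaPow_mul_mem ?_ ?_ m
      · rw [actHom_sMat_one]; exact neg_mem hφ
      · rw [mul_one, zetaPow_one, actHom_sMat_zeta]
        exact sub_mem (add_mem h1 hg) hφ
    · refine actHom_sMat_zetaPow_mul_mem ?_ ?_ m
      · rw [actHom_sMat_phiArith]; exact h1
      · rw [zetaPow_one, actHom_sMat_zeta_mul_phiArith]
        -- The product of `gArith` and φ would be quadratic in φ, but by `zeta_eq` it equals ζ - 1 -
        -- φ.
        have h : 1 + tauSeries - gArith * phiArith = (μ : ArithmeticFunction ℂ) + phiArith := by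
          rw [tauSeries_eq]
          linear_combination zeta_eq
        rw [h]
        exact add_mem hμ hφ
  | zero => rw [map_zero]; exact zero_mem _
  | add F G _ _ hF hG => rw [map_add]; exact add_mem hF hG
  | neg F _ hF => rw [map_neg]; exact neg_mem hF

lemma coe_rho_T_inv : (↑(rho ModularGroup.T)⁻¹ : Module.End ℂ (Col ℕ+)) = rhoMat jMatInv := by
  refine Units.inv_eq_of_mul_eq_one_right ?_
  rw [rho_T, ← map_mul, jMat_mul_jMatInv, map_one]

lemma actHom_rho_mem (Y : SL(2, ℤ)) {F : ArithmeticFunction ℂ} (hF : F ∈ zetaPhiSpan) :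
    actHom (rho Y) F ∈ zetaPhiSpan := by
  have hY : Y ∈ Subgroup.closure {ModularGroup.S, ModularGroup.T} := by
    rw [SpecialLinearGroup.SL2Z_generators]; trivial
  induction hY using Subgroup.closure_induction_right generalizing F with
  | one => rwa [map_one, Units.val_one, actHom_one]
  | mul_right X _ Y hY ih =>
    rw [map_mul, Units.val_mul, actHom_mul]
    rcases hY with rfl | rfl
    · rw [rho_S]; exact actHom_sMat_mem (ih hF)
    · rw [rho_T, actHom_rhoMat_jMat, ← zetaPow_one]; exact zetaPow_mul_mem 1 (ih hF)
  | mul_inv_cancel X _ Y hY ih =>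
    rw [map_mul, Units.val_mul, actHom_mul]
    rcases hY with rfl | rfl
    · have h : ModularGroup.S⁻¹ = ModularGroup.S * ModularGroup.S * ModularGroup.S := by decide
      rw [h, map_mul, map_mul, Units.val_mul, Units.val_mul, actHom_mul, actHom_mul, rho_S]
      exact actHom_sMat_mem (actHom_sMat_mem (actHom_sMat_mem (ih hF)))
    · rw [map_inv, coe_rho_T_inv, actHom_rhoMat_jMatInv, ← zetaPow_neg_one]
      exact zetaPow_mul_mem _ (ih hF)

lemma toArith_mem_of_mem_orbit {f : ℕ+ → ℂ} (hf : f ∈ orbit oneSeries) :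
    toArith f ∈ zetaPhiSpan := by
  obtain ⟨Y, rfl⟩ := hf
  rw [← actHom_rho_one]
  exact actHom_rho_mem Y one_mem_zetaPhiSpan

lemma orbit_act (f : ℕ+ → ℂ) (Y : SL(2, ℤ)) : orbit (act f (rho Y)) = orbit f := by
  have h : ∀ (g : ℕ+ → ℂ) (W V : SL(2, ℤ)), act (act g (rho W)) (rho V) = act g (rho (W * V)) := by
    intro g W V
    rw [map_mul, Units.val_mul, act_mul]
  apply Set.Subset.antisymm
  · rintro _ ⟨W, rfl⟩
    exact ⟨Y * W, (h f Y W).symm⟩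
  · rintro _ ⟨W, rfl⟩
    refine ⟨Y⁻¹ * W, ?_⟩
    simp only [h, mul_inv_cancel_left]

lemma zetaSeries_eq_act : zetaSeries = act oneSeries (rho ModularGroup.T) := by
  rw [rho_T, rhoMat_jMat]
  funext n
  rw [act_oneSeries, entry_D]
  simp [zetaSeries]

end Orbit

/-! ### Convergence and analyticity -/

section Analysis

open Filter Topology
open scoped ArithmeticFunction.zeta ArithmeticFunction.Moebius

/-! ### Partial sums of products of Dirichlet series -/

/-- The arithmetic function `F(n) n ^ (-s)`. -/
def twist (s : ℂ) (F : ArithmeticFunction ℂ) : ArithmeticFunction ℂ :=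
  ⟨fun n => F n * (n : ℂ) ^ (-s), by simp⟩

lemma twist_apply (s : ℂ) (F : ArithmeticFunction ℂ) (n : ℕ) :
    twist s F n = F n * (n : ℂ) ^ (-s) := rfl

lemma twist_mul (s : ℂ) (F G : ArithmeticFunction ℂ) : twist s (F * G) = twist s F * twist s G := by
  ext n
  rw [twist_apply, ArithmeticFunction.mul_apply, ArithmeticFunction.mul_apply, Finset.sum_mul]
  refine Finset.sum_congr rfl fun p hp => ?_
  rw [twist_apply, twist_apply, ← (Nat.mem_divisorsAntidiagonal.1 hp).1, Nat.cast_mul,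
    Complex.natCast_mul_natCast_cpow]
  ring

lemma sum_Ioc_eq_sum_range {M : Type*} [AddCommMonoid M] (f : ℕ → M) (N : ℕ) :
    ∑ n ∈ Finset.Ioc 0 N, f n = ∑ n ∈ Finset.range N, f (n + 1) := by
  induction N with
  | zero => simp
  | succ N ih => rw [Finset.sum_range_succ, ← ih, Finset.sum_Ioc_succ_top (Nat.zero_le N)]

lemma partialSum_eq (f : ℕ+ → ℂ) (s : ℂ) (N : ℕ) :
    partialSum f s N = ∑ n ∈ Finset.Ioc 0 N, twist s (toArith f) n := by
  rw [sum_Ioc_eq_sum_range]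
  refine Finset.sum_congr rfl fun n _ => ?_
  rw [twist_apply, toArith_succ]

/-- Convergence of the Dirichlet series of `F` at `s` with sum `l`. -/
def SumsTo (F : ArithmeticFunction ℂ) (s l : ℂ) : Prop :=
  Tendsto (fun N => ∑ n ∈ Finset.Ioc 0 N, twist s F n) atTop (𝓝 l)

lemma sumsTo_toArith {f : ℕ+ → ℂ} {s l : ℂ} :
    SumsTo (toArith f) s l ↔ Tendsto (partialSum f s) atTop (𝓝 l) := by
  rw [SumsTo, funext (partialSum_eq f s)]

/-- Mertens' theorem for Dirichlet convolution. -/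
lemma tendsto_sum_Ioc_mul {A B : ArithmeticFunction ℂ} {L : ℂ} (hA : Summable fun n => ‖A n‖)
    (hB : Tendsto (fun N => ∑ n ∈ Finset.Ioc 0 N, B n) atTop (𝓝 L)) :
    Tendsto (fun N => ∑ n ∈ Finset.Ioc 0 N, (A * B) n) atTop (𝓝 ((∑' n, A n) * L)) := by
  obtain ⟨C, hC⟩ := (Metric.isBounded_range_of_tendsto _ hB).exists_norm_le
  have hC' : ∀ N, ‖∑ n ∈ Finset.Ioc 0 N, B n‖ ≤ C := fun N => hC _ ⟨N, rfl⟩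
  have hC0 : 0 ≤ C := (norm_nonneg _).trans (hC' 0)
  -- Pairs with product at most N are grouped by their first member. Extending by zero turns the sum
  -- into a series with a fixed index set, ready for dominated convergence.
  have hsum : ∀ N, ∑ n ∈ Finset.Ioc 0 N, (A * B) n =
      ∑' n, if n ∈ Finset.Ioc 0 N then A n * ∑ m ∈ Finset.Ioc 0 (N / n), B m else 0 := by
    intro N
    rw [ArithmeticFunction.sum_Ioc_mul_eq_sum_sum, tsum_eq_sum (s := Finset.Ioc 0 N)]
    · exact Finset.sum_congr rfl fun n hn => (if_pos hn).symm
    · intro n hn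
      exact if_neg hn
  simp only [hsum]
  rw [← tsum_mul_right]
  refine tendsto_tsum_of_dominated_convergence (bound := fun n => ‖A n‖ * C)
    (hA.mul_right C) ?_ ?_
  · intro n
    rcases Nat.eq_zero_or_pos n with rfl | hn
    · simp
    · have h1 : Tendsto (fun N => A n * ∑ m ∈ Finset.Ioc 0 (N / n), B m) atTop (𝓝 (A n * L)) :=
        (hB.comp (Nat.tendsto_div_const_atTop hn.ne')).const_mul _
      refine h1.congr' ?_
      filter_upwards [eventually_ge_atTop n] with N hN
      rw [if_pos (Finset.mem_Ioc.2 ⟨hn, hN⟩)]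
  · refine Eventually.of_forall fun N n => ?_
    split_ifs
    · rw [norm_mul]
      exact mul_le_mul_of_nonneg_left (hC' _) (norm_nonneg _)
    · rw [norm_zero]
      positivity

lemma LSeries_term_eq_twist (F : ArithmeticFunction ℂ) (s : ℂ) :
    LSeries.term (fun n => F n) s = fun n => twist s F n := by
  funext n
  rcases Nat.eq_zero_or_pos n with rfl | hn
  · simp
  · rw [LSeries.term_of_ne_zero hn.ne', twist_apply, Complex.cpow_neg, div_eq_mul_inv]

lemma SumsTo.mul {F G : ArithmeticFunction ℂ} {s l : ℂ} (hF : LSeriesSummable (fun n => F n) s)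
    (hG : SumsTo G s l) : SumsTo (F * G) s (LSeries (fun n => F n) s * l) := by
  rw [LSeriesSummable, LSeries_term_eq_twist] at hF
  rw [LSeries, LSeries_term_eq_twist, SumsTo, twist_mul]
  exact tendsto_sum_Ioc_mul hF.norm hG

lemma sumsTo_one (s : ℂ) : SumsTo 1 s 1 := by
  refine tendsto_const_nhds.congr' ?_
  filter_upwards [eventually_ge_atTop 1] with N hN
  rw [Finset.sum_eq_single 1]
  · simp [twist_apply]
  · intro n _ hn
    simp [twist_apply, hn]
  · intro h
    exact absurd (Finset.mem_Ioc.2 ⟨one_pos, hN⟩) h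

lemma SumsTo.zeta_mul {G : ArithmeticFunction ℂ} {s l : ℂ} (hs : 1 < s.re) (hG : SumsTo G s l) :
    SumsTo (ζ * G) s (riemannZeta s * l) := by
  have h : LSeriesSummable (fun n => (ζ : ArithmeticFunction ℂ) n) s := by
    simpa using ArithmeticFunction.LSeriesSummable_zeta_iff.2 hs
  have h2 := SumsTo.mul h hG
  have h3 := ArithmeticFunction.LSeries_zeta_eq_riemannZeta hs
  simp only [ArithmeticFunction.natCoe_apply] at h2
  rwa [h3] at h2

lemma SumsTo.moebius_mul {G : ArithmeticFunction ℂ} {s l : ℂ} (hs : 1 < s.re)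
    (hG : SumsTo G s l) :
    SumsTo (μ * G) s ((riemannZeta s)⁻¹ * l) := by
  have h : LSeriesSummable (fun n => (μ : ArithmeticFunction ℂ) n) s := by
    simpa using ArithmeticFunction.LSeriesSummable_moebius_iff.2 hs
  have h2 := SumsTo.mul h hG
  have h3 := ArithmeticFunction.LSeries_zeta_mul_Lseries_moebius hs
  rw [ArithmeticFunction.LSeries_zeta_eq_riemannZeta hs] at h3
  simp only [ArithmeticFunction.intCoe_apply] at h2
  rwa [eq_inv_of_mul_eq_one_right h3] at h2

/-- Each step multiplies by ζ or μ, both absolutely convergent here, so G itself may converge only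
conditionally. -/
lemma SumsTo.zetaPow_mul {G : ArithmeticFunction ℂ} {s l : ℂ} (hs : 1 < s.re)
    (hG : SumsTo G s l) (m : ℤ) : SumsTo (zetaPow m * G) s (riemannZeta s ^ m * l) := by
  have h0 := riemannZeta_ne_zero_of_one_lt_re hs
  induction m using Int.induction_on with
  | zero => simpa [zetaPow_zero] using hG
  | succ i ih =>
    rw [add_comm, zetaPow_add, zpow_add₀ h0, zetaPow_one, zpow_one, mul_assoc, mul_assoc]
    exact ih.zeta_mul hs
  | pred i ih =>
    rw [sub_eq_add_neg, add_comm, zetaPow_add, zpow_add₀ h0, zetaPow_neg_one, zpow_neg_one,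
      mul_assoc, mul_assoc]
    exact ih.moebius_mul hs

/-! ### Absolute convergence of `φ` on a half-plane -/

/-- The arithmetic function `|F(n)| n ^ (-3)`. -/
def cubeNorm (F : ArithmeticFunction ℂ) : ArithmeticFunction ℝ :=
  ⟨fun n => ‖F n‖ / (n : ℝ) ^ 3, by simp⟩

lemma cubeNorm_apply (F : ArithmeticFunction ℂ) (n : ℕ) :
    cubeNorm F n = ‖F n‖ / (n : ℝ) ^ 3 := rfl

lemma cubeNorm_nonneg (F : ArithmeticFunction ℂ) (n : ℕ) : 0 ≤ cubeNorm F n := by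
  rw [cubeNorm_apply]; positivity

lemma cubeNorm_mul_le (F G : ArithmeticFunction ℂ) (n : ℕ) :
    cubeNorm (F * G) n ≤ (cubeNorm F * cubeNorm G) n := by
  rw [cubeNorm_apply, ArithmeticFunction.mul_apply, ArithmeticFunction.mul_apply]
  calc ‖∑ p ∈ n.divisorsAntidiagonal, F p.1 * G p.2‖ / (n : ℝ) ^ 3
      ≤ (∑ p ∈ n.divisorsAntidiagonal, ‖F p.1 * G p.2‖) / (n : ℝ) ^ 3 := by
        gcongr; exact norm_sum_le _ _
    _ = _ := by
        rw [Finset.sum_div]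
        refine Finset.sum_congr rfl fun p hp => ?_
        rw [cubeNorm_apply, cubeNorm_apply, ← (Nat.mem_divisorsAntidiagonal.1 hp).1, Nat.cast_mul,
          norm_mul, mul_pow, div_mul_div_comm]

/-- The partial sum of `∑ |F(n)| n ^ (-3)`. -/
def cubeSum (F : ArithmeticFunction ℂ) (N : ℕ) : ℝ := ∑ n ∈ Finset.Ioc 0 N, cubeNorm F n

lemma cubeSum_nonneg (F : ArithmeticFunction ℂ) (N : ℕ) : 0 ≤ cubeSum F N :=
  Finset.sum_nonneg fun n _ => cubeNorm_nonneg F n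

lemma cubeSum_mono (F : ArithmeticFunction ℂ) : Monotone (cubeSum F) := fun _ _ h =>
  Finset.sum_le_sum_of_subset_of_nonneg (Finset.Ioc_subset_Ioc_right h)
    fun n _ _ => cubeNorm_nonneg F n

lemma cubeSum_mul_le_sum (F G : ArithmeticFunction ℂ) (N : ℕ) :
    cubeSum (F * G) N ≤ ∑ n ∈ Finset.Ioc 0 N, cubeNorm F n * cubeSum G (N / n) := by
  refine (Finset.sum_le_sum fun n _ => cubeNorm_mul_le F G n).trans_eq ?_
  rw [ArithmeticFunction.sum_Ioc_mul_eq_sum_sum]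
  rfl

lemma cubeSum_mul_le (F G : ArithmeticFunction ℂ) (N : ℕ) :
    cubeSum (F * G) N ≤ cubeSum F N * cubeSum G N := by
  refine (cubeSum_mul_le_sum F G N).trans ?_
  conv_rhs => rw [cubeSum, Finset.sum_mul]
  exact Finset.sum_le_sum fun n _ =>
    mul_le_mul_of_nonneg_left (cubeSum_mono G (Nat.div_le_self N n)) (cubeNorm_nonneg F n)

/-- The term n = 1 is absent, and (N + 1) / n ≤ N for n ≥ 2. The drop from N + 1 to N on the factor
G is what makes induction on N possible. -/
lemma cubeSum_mul_succ_le {F : ArithmeticFunction ℂ} (hF : F 1 = 0) (G : ArithmeticFunction ℂ)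
    (N : ℕ) : cubeSum (F * G) (N + 1) ≤ cubeSum F (N + 1) * cubeSum G N := by
  refine (cubeSum_mul_le_sum F G (N + 1)).trans ?_
  conv_rhs => rw [cubeSum, Finset.sum_mul]
  refine Finset.sum_le_sum fun n hn => ?_
  rcases eq_or_ne n 1 with rfl | h1
  · rw [cubeNorm_apply, hF]; simp
  · refine mul_le_mul_of_nonneg_left (cubeSum_mono G ?_) (cubeNorm_nonneg F n)
    have hn2 : 1 < n := lt_of_le_of_ne (Finset.mem_Ioc.1 hn).1 h1.symm
    exact Nat.le_of_lt_succ (Nat.div_lt_self N.succ_pos hn2)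

lemma cubeSum_add_le (F G : ArithmeticFunction ℂ) (N : ℕ) :
    cubeSum (F + G) N ≤ cubeSum F N + cubeSum G N := by
  rw [cubeSum, cubeSum, cubeSum, ← Finset.sum_add_distrib]
  refine Finset.sum_le_sum fun n _ => ?_
  rw [cubeNorm_apply, cubeNorm_apply, cubeNorm_apply, ← add_div, ArithmeticFunction.add_apply]
  gcongr
  exact norm_add_le _ _

lemma cubeSum_neg (F : ArithmeticFunction ℂ) (N : ℕ) : cubeSum (-F) N = cubeSum F N := by
  refine Finset.sum_congr rfl fun n _ => ?_
  rw [cubeNorm_apply, cubeNorm_apply, ← norm_neg (F n)]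
  rfl

lemma cubeSum_sub_le (F G : ArithmeticFunction ℂ) (N : ℕ) :
    cubeSum (F - G) N ≤ cubeSum F N + cubeSum G N := by
  rw [sub_eq_add_neg]
  refine (cubeSum_add_le _ _ N).trans_eq ?_
  rw [cubeSum_neg]

lemma zeta_sub_one_apply_one : ((ζ : ArithmeticFunction ℂ) - 1) 1 = 0 := by
  change (ζ : ArithmeticFunction ℂ) 1 - (1 : ArithmeticFunction ℂ) 1 = 0
  simp

/-- For n ≥ 2, 1/n³ is compared with 1/((n - 1)n(n + 1)), which telescopes to a total of 1/4. -/
lemma cubeSum_zeta_sub_one_succ_le (N : ℕ) :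
    cubeSum ((ζ : ArithmeticFunction ℂ) - 1) (N + 1) ≤ 1 / 4 - 1 / (2 * (N + 1) * (N + 2)) := by
  induction N with
  | zero =>
    rw [cubeSum, zero_add, Finset.sum_Ioc_succ_top le_rfl]
    simp [cubeNorm_apply, zeta_sub_one_apply_one]
    norm_num
  | succ N ih =>
    have h1 : ((ζ : ArithmeticFunction ℂ) - 1) (N + 1 + 1) = 1 := by
      change (ζ : ArithmeticFunction ℂ) (N + 1 + 1) - (1 : ArithmeticFunction ℂ) (N + 1 + 1) = 1
      simp
    rw [cubeSum, Finset.sum_Ioc_succ_top (Nat.zero_le _), cubeNorm_apply, h1]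
    refine (add_le_add_left ih _).trans ?_
    have h2 : (1 : ℝ) / ((N : ℝ) + 2) ^ 3 ≤
        1 / (2 * (N + 1) * (N + 2)) - 1 / (2 * (N + 2) * (N + 3)) := by
      rw [show (1 : ℝ) / (2 * (N + 1) * (N + 2)) - 1 / (2 * (N + 2) * (N + 3)) =
        1 / ((N + 1) * (N + 2) * (N + 3)) by field_simp; ring]
      apply one_div_le_one_div_of_le (by positivity)
      have : (0 : ℝ) ≤ N := N.cast_nonneg
      nlinarith
    push_cast
    rw [norm_one, show (N : ℝ) + 1 + 1 = N + 2 by ring, show (N : ℝ) + 1 + 2 = N + 3 by ring]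
    linarith

lemma cubeSum_zeta_sub_one_le (N : ℕ) : cubeSum ((ζ : ArithmeticFunction ℂ) - 1) N ≤ 1 / 4 := by
  refine (cubeSum_mono _ (Nat.le_succ N)).trans ((cubeSum_zeta_sub_one_succ_le N).trans ?_)
  have : (0 : ℝ) ≤ 1 / (2 * ((N : ℝ) + 1) * (N + 2)) := by positivity
  linarith

lemma cubeSum_phiArith_le (N : ℕ) : cubeSum phiArith N ≤ 1 := by
  induction N with
  | zero => simp [cubeSum]
  | succ N ih =>
    have h0 := cubeSum_nonneg phiArith N
    have hz0 := cubeSum_nonneg ((ζ : ArithmeticFunction ℂ) - 1) (N + 1)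
    have hz := cubeSum_zeta_sub_one_le (N + 1)
    have h1 := cubeSum_mul_le ((ζ : ArithmeticFunction ℂ) - 1) ((ζ : ArithmeticFunction ℂ) - 1)
      (N + 1)
    have h2 := cubeSum_mul_succ_le zeta_sub_one_apply_one phiArith N
    have h3 := cubeSum_mul_succ_le zeta_sub_one_apply_one (phiArith * phiArith) N
    have h4 := cubeSum_mul_le phiArith phiArith N
    rw [phiArith_quadratic]
    refine (cubeSum_sub_le _ _ _).trans ?_
    refine (add_le_add_left (cubeSum_sub_le _ _ _) _).trans ?_
    refine (add_le_add_left (add_le_add_left (cubeSum_add_le _ _ _) _) _).trans ?_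
    have h5 : cubeSum phiArith N * cubeSum phiArith N ≤ 1 := mul_le_one₀ ih h0 ih
    have h6 := mul_le_mul hz hz hz0 (by norm_num)
    have h7 := mul_le_mul hz ih h0 (by norm_num)
    have h8 := mul_le_mul hz (h4.trans h5) (cubeSum_nonneg _ N) (by norm_num)
    -- The four terms of the quadratic equation contribute at most 1/4 + 1/16 + 1/4 + 1/4 = 13/16.
    linarith

lemma exists_sumsTo_phiArith {s : ℂ} (hs : 3 ≤ s.re) : ∃ l, SumsTo phiArith s l := by
  have hsum : Summable fun n : ℕ => cubeNorm phiArith (n + 1) := by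
    refine summable_of_sum_range_le (c := 1) (fun n => cubeNorm_nonneg _ _) fun N => ?_
    rw [← sum_Ioc_eq_sum_range fun n => cubeNorm phiArith n]
    exact cubeSum_phiArith_le N
  have hsum2 : Summable fun n : ℕ => twist s phiArith (n + 1) := by
    refine Summable.of_norm_bounded hsum fun n => ?_
    rw [twist_apply, cubeNorm_apply, norm_mul, Complex.norm_natCast_cpow_of_pos n.succ_pos,
      div_eq_mul_inv]
    gcongr
    rw [Complex.neg_re, Real.rpow_neg (by positivity), ← Real.rpow_natCast]
    gcongr
    · simp
    · simpa using hs
  refine ⟨∑' n : ℕ, twist s phiArith (n + 1), ?_⟩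
  rw [SumsTo]
  simp only [sum_Ioc_eq_sum_range]
  exact hsum2.hasSum.tendsto_sum_nat

/-! ### Analyticity of conditionally convergent Dirichlet series -/

lemma norm_cpow_neg_sub_le {w : ℂ} (hw : 0 < w.re) {x : ℝ} (hx : 0 < x) :
    ‖((x + 1 : ℝ) : ℂ) ^ (-w) - (x : ℂ) ^ (-w)‖ ≤ ‖w‖ * x ^ (-w.re - 1) := by
  have hd : ∀ t ∈ Set.Icc x (x + 1), HasDerivWithinAt (fun t : ℝ => (t : ℂ) ^ (-w))
      (-w * (t : ℂ) ^ (-w - 1)) (Set.Icc x (x + 1)) t := by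
    intro t ht
    have ht0 : 0 < t := hx.trans_le ht.1
    have h := ((hasDerivAt_id (t : ℂ)).cpow_const (c := -w)
      (Or.inl (by simpa using ht0))).comp_ofReal
    simpa using h.hasDerivWithinAt
  have hb : ∀ t ∈ Set.Icc x (x + 1), ‖-w * (t : ℂ) ^ (-w - 1)‖ ≤ ‖w‖ * x ^ (-w.re - 1) := by
    intro t ht
    have ht0 : 0 < t := hx.trans_le ht.1
    rw [norm_mul, norm_neg, Complex.norm_cpow_eq_rpow_re_of_pos ht0]
    gcongr
    simp only [Complex.sub_re, Complex.neg_re, Complex.one_re]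
    exact Real.rpow_le_rpow_of_nonpos hx ht.1 (by linarith)
  have h := (convex_Icc x (x + 1)).norm_image_sub_le_of_norm_hasDerivWithin_le hd hb
    (Set.left_mem_Icc.2 (by linarith)) (Set.right_mem_Icc.2 (by linarith))
  simpa using h

lemma sum_range_mul_eq_by_parts (a b : ℕ → ℂ) (N : ℕ) :
    ∑ n ∈ Finset.range N, a n * b n = (∑ n ∈ Finset.range N, a n) * b N -
      ∑ n ∈ Finset.range N, (∑ k ∈ Finset.range (n + 1), a k) * (b (n + 1) - b n) := by
  induction N with
  | zero => simp
  | succ N ih =>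
    rw [Finset.sum_range_succ, ih, Finset.sum_range_succ (fun n => _ * _),
      Finset.sum_range_succ a]
    ring

/-- Convergence at a real σ to the left of s₀ bounds the partial sums there. Partial summation
against (n + 1)^(-(s - σ)) then gives a series converging absolutely and uniformly near s₀, with
analytic terms. -/
lemma analyticOnNhd_of_sumsTo {F : ArithmeticFunction ℂ} {h : ℂ → ℂ} {a : ℝ}
    (hF : ∀ s ∈ halfPlane a, SumsTo F s (h s)) : AnalyticOnNhd ℂ h (halfPlane a) := by
  intro s₀ hs₀
  obtain ⟨σ, hσ1, hσ2⟩ := exists_between (show a < s₀.re from hs₀)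
  obtain ⟨σ', hσ'1, hσ'2⟩ := exists_between hσ2
  have h1 := hF σ (by simpa [halfPlane] using hσ1)
  rw [SumsTo] at h1
  simp only [sum_Ioc_eq_sum_range] at h1
  obtain ⟨C, hC⟩ := (Metric.isBounded_range_of_tendsto _ h1).exists_norm_le
  have hC' : ∀ N, ‖∑ n ∈ Finset.range N, twist σ F (n + 1)‖ ≤ C := fun N => hC _ ⟨N, rfl⟩
  have hC0 : 0 ≤ C := (norm_nonneg _).trans (hC' 0)
  let R := ‖s₀ - σ‖ + 1
  let U : Set ℂ := {s | σ' < s.re} ∩ Metric.ball s₀ 1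
  have hUo : IsOpen U := (isOpen_halfPlane σ').inter Metric.isOpen_ball
  -- On U the real part of s - σ exceeds σ' - σ > 0, and the norm of s - σ is at most R; these make
  -- the bound on `T n` uniform and summable.
  have hU0 : s₀ ∈ U := ⟨hσ'2, Metric.mem_ball_self one_pos⟩
  let b : ℂ → ℕ → ℂ := fun s n => ((n + 1 : ℕ) : ℂ) ^ (-(s - σ))
  let T : ℕ → ℂ → ℂ := fun n s =>
    (∑ k ∈ Finset.range (n + 1), twist σ F (k + 1)) * (b s (n + 1) - b s n)
  have hbound : ∀ n s, s ∈ U → ‖T n s‖ ≤ C * (R * ((n + 1 : ℕ) : ℝ) ^ (-(σ' - σ) - 1)) := by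
    intro n s hs
    have hre : σ' - σ < (s - σ).re := by
      have : σ' < s.re := hs.1
      simpa using this
    have hw : 0 < (s - σ).re := by linarith
    have hn := norm_cpow_neg_sub_le hw (x := ((n + 1 : ℕ) : ℝ)) (by positivity)
    have hR : ‖s - σ‖ ≤ R := by
      have h3 : ‖s - s₀‖ < 1 := by simpa [dist_eq_norm] using hs.2
      calc ‖s - σ‖ = ‖(s₀ - σ) + (s - s₀)‖ := by congr 1; ring
        _ ≤ ‖s₀ - σ‖ + ‖s - s₀‖ := norm_add_le _ _
        _ ≤ R := add_le_add_right h3.le _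
    rw [norm_mul]
    refine mul_le_mul (hC' _) ?_ (norm_nonneg _) hC0
    have e : b s (n + 1) - b s n = (((((n + 1 : ℕ) : ℝ) + 1 : ℝ) : ℂ) ^ (-(s - σ))) -
        ((((n + 1 : ℕ) : ℝ) : ℂ)) ^ (-(s - σ)) := by
      simp [b]
    rw [e]
    refine hn.trans (mul_le_mul hR ?_ (by positivity) ((norm_nonneg _).trans hR))
    exact Real.rpow_le_rpow_of_exponent_le (by simp) (by linarith)
  have hsum : Summable fun n : ℕ => C * (R * ((n + 1 : ℕ) : ℝ) ^ (-(σ' - σ) - 1)) := by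
    refine Summable.mul_left _ (Summable.mul_left _ ?_)
    exact (summable_nat_add_iff 1).2 (Real.summable_nat_rpow.2 (by linarith))
  have hT : ∀ n, DifferentiableOn ℂ (T n) U := by
    intro n s _
    refine DifferentiableAt.differentiableWithinAt ?_
    have hb : ∀ m, DifferentiableAt ℂ (fun s => b s m) s := by
      intro m
      refine DifferentiableAt.const_cpow (by fun_prop) (Or.inl ?_)
      exact Nat.cast_ne_zero.2 m.succ_ne_zero
    exact ((hb _).sub (hb _)).const_mul _
  have hdiff := Complex.differentiableOn_tsum_of_summable_norm hsum hT hUo hbound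
  have heq : Set.EqOn h (fun s => -∑' n, T n s) U := by
    intro s hs
    have hre : σ' < s.re := hs.1
    have h2 := hF s (show a < s.re by linarith)
    rw [SumsTo] at h2
    simp only [sum_Ioc_eq_sum_range] at h2
    refine tendsto_nhds_unique h2 ?_
    have hterm : ∀ n : ℕ, twist s F (n + 1) = twist σ F (n + 1) * b s n := by
      intro n
      rw [twist_apply, twist_apply, mul_assoc, ← Complex.cpow_add _ _
        (Nat.cast_ne_zero.2 n.succ_ne_zero)]
      congr 2
      ring
    simp only [hterm]
    refine Tendsto.congr (fun N => (sum_range_mul_eq_by_parts _ _ N).symm) ?_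
    rw [← zero_sub]
    refine Tendsto.sub ?_ ?_
    -- The boundary term vanishes in the limit: bounded partial sums times a negative power of N +
    -- 1.
    · rw [tendsto_zero_iff_norm_tendsto_zero]
      refine squeeze_zero (fun _ => norm_nonneg _) (g := fun N : ℕ =>
        C * ((N + 1 : ℕ) : ℝ) ^ (-(s.re - σ))) (fun N => ?_) ?_
      · rw [norm_mul]
        refine mul_le_mul (hC' N) ?_ (norm_nonneg _) hC0
        rw [Complex.norm_natCast_cpow_of_pos N.succ_pos]
        simp
      · rw [← mul_zero C]
        refine Tendsto.const_mul _ ?_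
        exact ((tendsto_rpow_neg_atTop (by linarith)).comp tendsto_natCast_atTop_atTop).comp
          (tendsto_add_atTop_nat 1)
    · exact (Summable.of_norm_bounded hsum fun n => hbound n s hs).hasSum.tendsto_sum_nat
  have h5 : DifferentiableOn ℂ h U := hdiff.neg.congr heq
  exact h5.analyticAt (hUo.mem_nhds hU0)

end Analysis

/-! ### Passage to the field of meromorphic functions -/

section Meromorphic

open Filter Topology
open scoped ArithmeticFunction.zeta ArithmeticFunction.Moebius

/-! ### Functions in the field of meromorphic functions -/

/-- Values off the half-plane do not affect the germ; this matters because `seriesSum` is a default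
value where the series diverges. -/
lemma Mero.mk_congr {a : ℝ} {f g : ℂ → ℂ} (hf : MeromorphicOn f (halfPlane a))
    (hg : MeromorphicOn g (halfPlane a)) (h : Set.EqOn f g (halfPlane a)) :
    Mero.mk f hf = Mero.mk g hg := by
  rw [Mero.mk_eq_mk_iff, EventuallyEq, Filter.Eventually, mem_codiscreteWithin_iff_forall_mem_nhdsNE]
  intro x _
  refine univ_mem' fun y => ?_
  by_cases hy : y ∈ halfPlane a
  · exact Or.inl (h hy)
  · exact Or.inr hy

lemma Mero.mk_mul {a : ℝ} {f g : ℂ → ℂ} (hf : MeromorphicOn f (halfPlane a))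
    (hg : MeromorphicOn g (halfPlane a)) :
    Mero.mk (f * g) (hf.mul hg) = Mero.mk f hf * Mero.mk g hg := rfl

lemma Mero.mk_add {a : ℝ} {f g : ℂ → ℂ} (hf : MeromorphicOn f (halfPlane a))
    (hg : MeromorphicOn g (halfPlane a)) :
    Mero.mk (f + g) (hf.add hg) = Mero.mk f hf + Mero.mk g hg := rfl

lemma Mero.mk_neg {a : ℝ} {f : ℂ → ℂ} (hf : MeromorphicOn f (halfPlane a)) :
    Mero.mk (-f) hf.neg = -Mero.mk f hf := rfl

lemma Mero.mk_one {a : ℝ} : Mero.mk (a := a) (fun _ => 1) (MeromorphicOn.const 1) = 1 := rfl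

lemma Mero.mk_zero {a : ℝ} : Mero.mk (a := a) (fun _ => 0) (MeromorphicOn.const 0) = 0 := rfl

lemma Mero.mk_zpow {a : ℝ} {f : ℂ → ℂ} (hf : MeromorphicOn f (halfPlane a))
    (h0 : ∀ s ∈ halfPlane a, f s ≠ 0) (m : ℤ) :
    Mero.mk (f ^ m) (hf.zpow m) = Mero.mk f hf ^ m := by
  -- Inversion in `Mero a` comes from `Mero.isField` and is not given by a formula, so it is
  -- identified through uniqueness of inverses.
  have hinv : Mero.mk f hf * Mero.mk f⁻¹ hf.inv = 1 := by
    rw [← Mero.mk_mul, ← Mero.mk_one]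
    exact Mero.mk_congr _ _ fun s hs => mul_inv_cancel₀ (h0 s hs)
  have hne : Mero.mk f hf ≠ 0 := left_ne_zero_of_mul_eq_one hinv
  induction m using Int.induction_on with
  | zero =>
    rw [zpow_zero (Mero.mk f hf), ← Mero.mk_one]
    exact Mero.mk_congr _ _ fun s _ => zpow_zero (f s)
  | succ i ih =>
    rw [zpow_add₀ hne, zpow_one, ← ih, ← Mero.mk_mul]
    exact Mero.mk_congr _ _ fun s hs => zpow_add_one₀ (h0 s hs) _
  | pred i ih =>
    rw [sub_eq_add_neg, zpow_add₀ hne, zpow_neg_one, ← eq_inv_of_mul_eq_one_right hinv, ← ih,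
      ← Mero.mk_mul]
    exact Mero.mk_congr _ _ fun s hs => zpow_sub_one₀ (h0 s hs) _

lemma seriesSum_eq {f : ℕ+ → ℂ} {s l : ℂ} (h : SumsTo (toArith f) s l) : seriesSum f s = l :=
  (sumsTo_toArith.1 h).limUnder_eq

lemma SumsTo.add {F G : ArithmeticFunction ℂ} {s l m : ℂ} (hF : SumsTo F s l)
    (hG : SumsTo G s m) : SumsTo (F + G) s (l + m) := by
  refine (Tendsto.add hF hG).congr fun N => ?_
  rw [← Finset.sum_add_distrib]
  refine Finset.sum_congr rfl fun n _ => ?_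
  rw [twist_apply, twist_apply, twist_apply, ArithmeticFunction.add_apply, add_mul]

lemma SumsTo.neg {F : ArithmeticFunction ℂ} {s l : ℂ} (hF : SumsTo F s l) :
    SumsTo (-F) s (-l) := by
  refine (Tendsto.neg hF).congr fun N => ?_
  rw [← Finset.sum_neg_distrib]
  refine Finset.sum_congr rfl fun n _ => ?_
  rw [twist_apply, twist_apply, ← neg_mul]
  rfl

lemma sumsTo_zero (s : ℂ) : SumsTo 0 s 0 := by
  refine tendsto_const_nhds.congr fun N => ?_
  simp [twist_apply]

/-- Transfers the formal membership to functions, generator by generator. The generators involve φ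
at most linearly, so conditional convergence of φ is enough; a ≥ 1 makes ζ and μ absolutely
convergent and ζ(s) nonzero. -/
lemma exists_sumsTo_mem_closure {a : ℝ} (ha : 1 ≤ a) {Φ : ℂ → ℂ}
    (hΦ : ∀ s ∈ halfPlane a, SumsTo phiArith s (Φ s))
    (hζ : MeromorphicOn riemannZeta (halfPlane a)) (hφ : MeromorphicOn Φ (halfPlane a))
    {F : ArithmeticFunction ℂ} (hF : F ∈ zetaPhiSpan) :
    ∃ h : ℂ → ℂ, (∀ s ∈ halfPlane a, SumsTo F s (h s)) ∧
      ∃ hm : MeromorphicOn h (halfPlane a), Mero.mk h hm ∈ AddSubgroup.closure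
        ({F | ∃ m : ℤ, F = Mero.mk riemannZeta hζ ^ m} ∪
          {F | ∃ m : ℤ, F = Mero.mk Φ hφ * Mero.mk riemannZeta hζ ^ m}) := by
  have hre : ∀ s ∈ halfPlane a, 1 < s.re := fun s hs => ha.trans_lt hs
  have h0 : ∀ s ∈ halfPlane a, riemannZeta s ≠ 0 := fun s hs =>
    riemannZeta_ne_zero_of_one_lt_re (hre s hs)
  induction hF using AddSubgroup.closure_induction with
  | mem F h =>
    rcases h with ⟨m, rfl⟩ | ⟨m, rfl⟩
    · refine ⟨riemannZeta ^ m, fun s hs => ?_, hζ.zpow m, ?_⟩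
      · simpa using (sumsTo_one s).zetaPow_mul (hre s hs) m
      · exact AddSubgroup.subset_closure (Or.inl ⟨m, Mero.mk_zpow hζ h0 m⟩)
    · refine ⟨riemannZeta ^ m * Φ, fun s hs => (hΦ s hs).zetaPow_mul (hre s hs) m,
        (hζ.zpow m).mul hφ, ?_⟩
      refine AddSubgroup.subset_closure (Or.inr ⟨m, ?_⟩)
      rw [Mero.mk_mul (hζ.zpow m) hφ, Mero.mk_zpow hζ h0, mul_comm]
  | zero =>
    refine ⟨fun _ => 0, fun s _ => sumsTo_zero s, MeromorphicOn.const 0, ?_⟩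
    rw [Mero.mk_zero]
    exact zero_mem _
  | add F G _ _ hF hG =>
    obtain ⟨f, hf, hfm, hf'⟩ := hF
    obtain ⟨g, hg, hgm, hg'⟩ := hG
    refine ⟨f + g, fun s hs => (hf s hs).add (hg s hs), hfm.add hgm, ?_⟩
    rw [Mero.mk_add hfm hgm]
    exact add_mem hf' hg'
  | neg F _ hF =>
    obtain ⟨f, hf, hfm, hf'⟩ := hF
    refine ⟨-f, fun s hs => (hf s hs).neg, hfm.neg, ?_⟩
    rw [Mero.mk_neg hfm]
    exact neg_mem hf'

/-! ### The abscissa of convergence of `φ` -/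

lemma abscissa_phiSeries_le : abscissa phiSeries ≤ (3 : ℝ) := by
  refine sInf_le ⟨3, fun s hs => ?_, rfl⟩
  obtain ⟨l, hl⟩ := exists_sumsTo_phiArith hs.le
  exact ⟨l, sumsTo_toArith.1 hl⟩

/-- The bound 3 excludes +∞, and the maximum with 1 excludes -∞. -/
lemma exists_coe_eq_max_abscissa : ∃ a : ℝ, (a : EReal) = max 1 (abscissa phiSeries) := by
  refine ⟨(max 1 (abscissa phiSeries)).toReal, EReal.coe_toReal ?_ ?_⟩
  · refine (max_lt (EReal.coe_lt_top 1) ?_).ne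
    exact abscissa_phiSeries_le.trans_lt (EReal.coe_lt_top 3)
  · exact (lt_max_of_lt_left (EReal.bot_lt_coe 1)).ne'

lemma convergesAt_of_abscissa_lt {f : ℕ+ → ℂ} {s : ℂ} (h : abscissa f < (s.re : EReal)) :
    ConvergesAt f s := by
  obtain ⟨_, ⟨σ, hσ, rfl⟩, hlt⟩ := sInf_lt_iff.1 h
  exact hσ s (EReal.coe_lt_coe_iff.1 hlt)

lemma sumsTo_phiArith_seriesSum {s : ℂ} (h : abscissa phiSeries < (s.re : EReal)) :
    SumsTo phiArith s (seriesSum phiSeries s) :=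
  sumsTo_toArith.2 (tendsto_nhds_limUnder (convergesAt_of_abscissa_lt h))

end Meromorphic

end DivisorSL2

end

/-! ### Proof of the theorem -/

open DivisorSL2 in
theorem mainTheorem6 :
    DivisorSL2.orbit DivisorSL2.zetaSeries = DivisorSL2.orbit DivisorSL2.oneSeries ∧
    DivisorSL2.orbit DivisorSL2.phiSeries = DivisorSL2.orbit DivisorSL2.oneSeries ∧
    ∃ a : ℝ, (a : EReal) = max 1 (DivisorSL2.abscissa DivisorSL2.phiSeries) ∧
      (∀ f ∈ DivisorSL2.orbit DivisorSL2.oneSeries, ∀ s ∈ DivisorSL2.halfPlane a,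
        DivisorSL2.ConvergesAt f s) ∧
      (∀ f ∈ DivisorSL2.orbit DivisorSL2.oneSeries,
        AnalyticOnNhd ℂ (DivisorSL2.seriesSum f) (DivisorSL2.halfPlane a)) ∧
      ∃ (hζ : MeromorphicOn riemannZeta (DivisorSL2.halfPlane a))
        (hφ : MeromorphicOn (DivisorSL2.seriesSum DivisorSL2.phiSeries) (DivisorSL2.halfPlane a)),
        ∀ f ∈ DivisorSL2.orbit DivisorSL2.oneSeries,
          ∃ hf : MeromorphicOn (DivisorSL2.seriesSum f) (DivisorSL2.halfPlane a),
            DivisorSL2.Mero.mk (DivisorSL2.seriesSum f) hf ∈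
              IntermediateField.adjoin ℂ
                {DivisorSL2.Mero.mk riemannZeta hζ,
                  DivisorSL2.Mero.mk (DivisorSL2.seriesSum DivisorSL2.phiSeries) hφ} ∧
            DivisorSL2.Mero.mk (DivisorSL2.seriesSum f) hf ∈
              AddSubgroup.closure
                ({F | ∃ m : ℤ, F = DivisorSL2.Mero.mk riemannZeta hζ ^ m} ∪
                  {F | ∃ m : ℤ,
                    F = DivisorSL2.Mero.mk (DivisorSL2.seriesSum DivisorSL2.phiSeries) hφ *
                      DivisorSL2.Mero.mk riemannZeta hζ ^ m}) := by
  refine ⟨?_, orbit_act _ _, ?_⟩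
  · rw [zetaSeries_eq_act]
    exact orbit_act _ _
  obtain ⟨a, ha⟩ := exists_coe_eq_max_abscissa
  have ha1 : 1 ≤ a := by
    have h : ((1 : ℝ) : EReal) ≤ (a : EReal) := ha ▸ le_max_left _ _
    exact EReal.coe_le_coe_iff.1 h
  have hΦ : ∀ s ∈ halfPlane a, SumsTo phiArith s (seriesSum phiSeries s) := by
    intro s hs
    refine sumsTo_phiArith_seriesSum (lt_of_le_of_lt ?_ (EReal.coe_lt_coe_iff.2 hs))
    rw [ha]
    exact le_max_right _ _
  have hφ : MeromorphicOn (seriesSum phiSeries) (halfPlane a) :=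
    (analyticOnNhd_of_sumsTo hΦ).meromorphicOn
  -- The general analyticity result applies, as ζ(s) is the sum of its own Dirichlet series on the
  -- half-plane.
  have hζ : MeromorphicOn riemannZeta (halfPlane a) := by
    have hone : ∀ s ∈ halfPlane a, SumsTo (zetaPow 1 * 1) s (riemannZeta s) := by
      intro s hs
      simpa using (sumsTo_one s).zetaPow_mul (ha1.trans_lt hs) 1
    exact (analyticOnNhd_of_sumsTo hone).meromorphicOn
  have key : ∀ f ∈ orbit oneSeries, ∃ h : ℂ → ℂ, (∀ s ∈ halfPlane a, SumsTo (toArith f) s (h s)) ∧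
      ∃ hm : MeromorphicOn h (halfPlane a), Mero.mk h hm ∈ AddSubgroup.closure
        ({F | ∃ m : ℤ, F = Mero.mk riemannZeta hζ ^ m} ∪
          {F | ∃ m : ℤ, F = Mero.mk (seriesSum phiSeries) hφ * Mero.mk riemannZeta hζ ^ m}) :=
    fun f hf => exists_sumsTo_mem_closure ha1 hΦ hζ hφ (toArith_mem_of_mem_orbit hf)
  have hsum : ∀ f ∈ orbit oneSeries, ∀ s ∈ halfPlane a, SumsTo (toArith f) s (seriesSum f s) := by
    intro f hf s hs
    obtain ⟨h, hh, -⟩ := key f hf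
    rw [seriesSum_eq (hh s hs)]
    exact hh s hs
  refine ⟨a, ha, fun f hf s hs => ⟨_, sumsTo_toArith.1 (hsum f hf s hs)⟩,
    fun f hf => analyticOnNhd_of_sumsTo (hsum f hf), hζ, hφ, fun f hf => ?_⟩
  have hfm : MeromorphicOn (seriesSum f) (halfPlane a) :=
    (analyticOnNhd_of_sumsTo (hsum f hf)).meromorphicOn
  obtain ⟨h, hh, hm, hmem⟩ := key f hf
  rw [← Mero.mk_congr hfm hm fun s hs => seriesSum_eq (hh s hs)] at hmem
  refine ⟨hfm, ?_, hmem⟩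
  -- Membership in the subfield follows from the finer additive statement, since the generators are
  -- products of powers of the two field generators.
  have hle : AddSubgroup.closure
      ({F | ∃ m : ℤ, F = Mero.mk riemannZeta hζ ^ m} ∪
        {F | ∃ m : ℤ, F = Mero.mk (seriesSum phiSeries) hφ * Mero.mk riemannZeta hζ ^ m}) ≤
      (IntermediateField.adjoin ℂ
        {Mero.mk riemannZeta hζ, Mero.mk (seriesSum phiSeries) hφ}).toSubfield.toAddSubgroup := by
    rw [AddSubgroup.closure_le]
    have h1 : Mero.mk riemannZeta hζ ∈ IntermediateField.adjoin ℂ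
        {Mero.mk riemannZeta hζ, Mero.mk (seriesSum phiSeries) hφ} :=
      IntermediateField.subset_adjoin _ _ (Or.inl rfl)
    have h2 : Mero.mk (seriesSum phiSeries) hφ ∈ IntermediateField.adjoin ℂ
        {Mero.mk riemannZeta hζ, Mero.mk (seriesSum phiSeries) hφ} :=
      IntermediateField.subset_adjoin _ _ (Or.inr rfl)
    rintro _ (⟨m, rfl⟩ | ⟨m, rfl⟩)
    · exact zpow_mem h1 m
    · exact IntermediateField.mul_mem _ h2 (zpow_mem h1 m)
  exact hle hmem
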